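/- Let $\mathcal D$ be a finite set. Let $\mathcal T$ be the set of planar rooted trees whose vertices are decorated by elements of $\mathcal D$, with edges oriented away from the root, and let $\mathcal H=\mathcal H^{\mathcal D}_{P,R}$ be the free (noncommutative) unital associative $\mathbb Q$-algebra generated by $\mathcal T$. Its monomials $t_1\cdots t_n$ are the planar forests (with $1$ the empty forest), and they form a basis of $\mathcal H$. The algebra $\mathcal H$ is a Hopf algebra for the algebra morphism $\Delta:\mathcal H\to\mathcal H\otimes\mathcal H$ given on trees by $$\Delta(t)=t\otimes 1+1\otimes t+\sum_{c} P^c(t)\otimes R^c(t),$$ where $c$ runs over the admissible cuts of $t$ (nonempty sets of edges such that every oriented path meets at most one of them), $R^c(t)$ is the component of the root after the cut and $P^c(t)$ is the planar forest formed by the other components; its counit $\varepsilon$ maps every nonempty forest to $0$. It is graded by the weight, i.e. the number of vertices: $\mathcal H_n$ is the span of the forests with $n$ vertices, which is finite dimensional. Let $\mathcal H^{*g}=\{f\in\mathcal H^*:\exists n_0\ \forall n\ge n_0,\ f(\mathcal H_n)=0\}$ be the graded dual, with grading $(\mathcal H^{*g})_n=\{f\in\mathcal H^{*}: f(\mathcal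 H_k)=0 \text{ for all } k\neq n\}$ and with the Hopf algebra structure $(fg)(x)=(f\otimes g)(\Delta(x))$, $1_{\mathcal H^{*g}}=\varepsilon$, $\Delta(f)(x\otimes y)=f(xy)$, $\varepsilon(f)=f(1)$, $S(f)=f\circ S$. For $d\in\mathcal D$, let $B_d^+:\mathcal H\to\mathcal H$ be the linear map sending a forest $t_1\cdots t_n$ to the tree obtained by grafting $t_1,\dots,t_n$, in this order, on a common root decorated by $d$. Let $\gamma_d:\mathcal H\to\mathcal H$ be the linear map with $\gamma_d(1)=0$ and, for $n\geq 1$, $\gamma_d(t_1\cdots t_n)=t_1\cdots t_{n-1}$ if $t_n=\bullet_d$ is the single vertex decorated by $d$, and $\gamma_d(t_1\cdots t_n)=0$ otherwise. Let $\gamma_d^{*g}:\mathcal H^{*g}\to\mathcal H^{*g}$, $f\mapsto f\circ\gamma_d$, be its transpose. Then there is a unique bialgebra morphism $\Psi:\mathcal H\to\mathcal H^{*g}$ such that $\Psi\circ B_d^+=\gamma_d^{*g}\circ\Psi$ for all $d\in\mathcal D$, and $\Psi$ is an isomorphism of graded Hopf algebras: it is bijective, it is compatible with products, units, coproducts, counits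 and antipodes, and $\Psi(\mathcal H_n)=(\mathcal H^{*g})_n$ for all $n$. In particular $\mathcal H^{\mathcal D}_{P,R}$ is isomorphic, as a graded Hopf algebra, to its own graded dual. -/

import Mathlib

open scoped TensorProduct

section GradedDual

open Coalgebra HopfAlgebra WithConv

variable {K A : Type*} [Field K] [Ring A]

/-- The grading of `A ⊗ A`: the component of weight `n` is `∑_{k+l=n} A_k ⊗ A_l`. -/
def tensorGrading [Algebra K A] (𝒜 : ℕ → Submodule K A) (n : ℕ) : Submodule K (A ⊗[K] A) :=
  Submodule.span K {z | ∃ k l a b, k + l = n ∧ a ∈ 𝒜 k ∧ b ∈ 𝒜 l ∧ z = a ⊗ₜ[K] b}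

/-- A graded Hopf algebra with finite dimensional homogeneous components: a graded algebra whose
coproduct, counit and antipode are homogeneous of degree `0`. -/
class IsGradedHopfAlgebra [HopfAlgebra K A] (𝒜 : ℕ → Submodule K A) [GradedAlgebra 𝒜] :
    Prop where
  comul_mem : ∀ n, ∀ x ∈ 𝒜 n, comul (R := K) x ∈ tensorGrading 𝒜 n
  counit_eq_zero : ∀ n, n ≠ 0 → ∀ x ∈ 𝒜 n, counit (R := K) x = 0
  antipode_mem : ∀ n, ∀ x ∈ 𝒜 n, antipode K x ∈ 𝒜 n
  finite : ∀ n, FiniteDimensional K (𝒜 n)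

section Antipode

variable [Bialgebra K A] (𝒜 : ℕ → Submodule K A)

theorem conv_congr {B : Type*} [Ring B] [Algebra K B] {n : ℕ}
    (f g f' g' : WithConv (A →ₗ[K] B)) {x : A} (hx : comul (R := K) x ∈ tensorGrading 𝒜 n)
    (h : ∀ k l a b, k + l = n → a ∈ 𝒜 k → b ∈ 𝒜 l →
      f.ofConv a * g.ofConv b = f'.ofConv a * g'.ofConv b) :
    (f * g).ofConv x = (f' * g').ofConv x := by
  change LinearMap.mul' K B (TensorProduct.map f.ofConv g.ofConv (comul x)) =
    LinearMap.mul' K B (TensorProduct.map f'.ofConv g'.ofConv (comul x))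
  generalize comul (R := K) x = y at hx
  induction hx using Submodule.span_induction with
  | mem z hz =>
    obtain ⟨k, l, a, b, hkl, ha, hb, rfl⟩ := hz
    simpa using h k l a b hkl ha hb
  | zero => simp
  | add z w _ _ hz hw => simp only [map_add, hz, hw]
  | smul r z _ hz => simp only [map_smul, hz]

theorem conv_mem {n : ℕ} (f g : WithConv (A →ₗ[K] A)) [SetLike.GradedMonoid 𝒜]
    {x : A} (hx : comul (R := K) x ∈ tensorGrading 𝒜 n)
    (hf : ∀ k, ∀ a ∈ 𝒜 k, f.ofConv a ∈ 𝒜 k) (hg : ∀ k, ∀ a ∈ 𝒜 k, g.ofConv a ∈ 𝒜 k) :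
    (f * g).ofConv x ∈ 𝒜 n := by
  change LinearMap.mul' K A (TensorProduct.map f.ofConv g.ofConv (comul x)) ∈ _
  generalize comul (R := K) x = y at hx
  induction hx using Submodule.span_induction with
  | mem z hz =>
    obtain ⟨k, l, a, b, rfl, ha, hb, rfl⟩ := hz
    simpa using SetLike.mul_mem_graded (hf k a ha) (hg l b hb)
  | zero => simp
  | add z w _ _ hz hw => simpa only [map_add] using add_mem hz hw
  | smul r z _ hz => simpa only [map_smul] using Submodule.smul_mem _ r hz

/-- `η ∘ ε - id`, as an element of the convolution algebra. -/
noncomputable def convNil (K A : Type*) [Field K] [Ring A] [Bialgebra K A] :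
    WithConv (A →ₗ[K] A) :=
  1 - toConv LinearMap.id

theorem convNil_apply (x : A) :
    (convNil K A).ofConv x = algebraMap K A (counit (R := K) x) - x := rfl

theorem convNil_pow_apply {𝒜 : ℕ → Submodule K A}
    (hΔ : ∀ n, ∀ x ∈ 𝒜 n, comul (R := K) x ∈ tensorGrading 𝒜 n)
    (h0 : ∀ x ∈ 𝒜 0, algebraMap K A (counit (R := K) x) = x)
    (n : ℕ) : ∀ m < n, ∀ x ∈ 𝒜 m, (convNil K A ^ n).ofConv x = 0 := by
  induction n with
  | zero => simp
  | succ n ih =>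
    intro m hm x hx
    rw [pow_succ', conv_congr 𝒜 _ _ 0 0 (hΔ m x hx)]
    · simp
    · intro k l a b hkl ha hb
      rcases Nat.eq_zero_or_pos k with rfl | hk
      · rw [convNil_apply, h0 a ha]
        simp
      · rw [ih l (by omega) b hb]
        simp

variable [GradedAlgebra 𝒜]

/-- The geometric series `∑ (η ∘ ε - id)^n`, which is a finite sum on each homogeneous component
of a connected graded bialgebra. -/
noncomputable def convInverse : A →ₗ[K] A :=
  DirectSum.toModule K ℕ A (fun i =>
    (∑ n ∈ Finset.range (i + 1), convNil K A ^ n).ofConv ∘ₗ (𝒜 i).subtype) ∘ₗ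
    (DirectSum.decomposeLinearEquiv 𝒜).toLinearMap

variable {𝒜}

theorem convInverse_apply {i : ℕ} {x : A} (hx : x ∈ 𝒜 i) : convInverse 𝒜 x =
    (∑ n ∈ Finset.range (i + 1), convNil K A ^ n).ofConv x := by
  simp only [convInverse, LinearMap.comp_apply, LinearEquiv.coe_coe,
    DirectSum.decomposeLinearEquiv_apply, DirectSum.decompose_of_mem 𝒜 hx]
  exact DirectSum.toModule_lof K (M := fun i => 𝒜 i) i ⟨x, hx⟩

theorem convInverse_apply_of_le
    (hΔ : ∀ n, ∀ x ∈ 𝒜 n, comul (R := K) x ∈ tensorGrading 𝒜 n)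
    (h0 : ∀ x ∈ 𝒜 0, algebraMap K A (counit (R := K) x) = x)
    {i N : ℕ} (hi : i ≤ N) {x : A} (hx : x ∈ 𝒜 i) :
    convInverse 𝒜 x = (∑ n ∈ Finset.range (N + 1), convNil K A ^ n).ofConv x := by
  rw [convInverse_apply hx]
  simp only [ofConv_sum, LinearMap.sum_apply]
  refine Finset.sum_subset (by simpa using hi) fun n _ hn => ?_
  exact convNil_pow_apply hΔ h0 n i (by simpa using hn) x hx

theorem linearMap_ext_graded {B : Type*} [AddCommGroup B] [Module K B] {f g : A →ₗ[K] B}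
    (h : ∀ n, ∀ x ∈ 𝒜 n, f x = g x) : f = g := by
  ext x
  induction x using DirectSum.Decomposition.inductionOn 𝒜 with
  | zero => simp
  | homogeneous m => exact h _ _ m.2
  | add x y hx hy => rw [map_add, map_add, hx, hy]

theorem convInverse_mul
    (hΔ : ∀ n, ∀ x ∈ 𝒜 n, comul (R := K) x ∈ tensorGrading 𝒜 n)
    (h0 : ∀ x ∈ 𝒜 0, algebraMap K A (counit (R := K) x) = x) :
    toConv (convInverse 𝒜) * toConv LinearMap.id = 1 := by
  refine WithConv.ext (linearMap_ext_graded (𝒜 := 𝒜) fun m x hx => ?_)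
  rw [conv_congr 𝒜 _ _ (∑ n ∈ Finset.range (m + 1), convNil K A ^ n) (1 - convNil K A) (hΔ m x hx),
    geom_sum_mul_neg]
  · have := convNil_pow_apply hΔ h0 (m + 1) m (by omega) x hx
    simp [this]
  · intro k l a b hkl ha hb
    rw [ofConv_toConv, convInverse_apply_of_le hΔ h0 (show k ≤ m by omega) ha]
    simp [convNil]

theorem mul_convInverse
    (hΔ : ∀ n, ∀ x ∈ 𝒜 n, comul (R := K) x ∈ tensorGrading 𝒜 n)
    (h0 : ∀ x ∈ 𝒜 0, algebraMap K A (counit (R := K) x) = x) :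
    toConv LinearMap.id * toConv (convInverse 𝒜) = 1 := by
  refine WithConv.ext (linearMap_ext_graded (𝒜 := 𝒜) fun m x hx => ?_)
  rw [conv_congr 𝒜 _ _ (1 - convNil K A) (∑ n ∈ Finset.range (m + 1), convNil K A ^ n) (hΔ m x hx),
    mul_neg_geom_sum]
  · have := convNil_pow_apply hΔ h0 (m + 1) m (by omega) x hx
    simp [this]
  · intro k l a b hkl ha hb
    rw [ofConv_toConv, ofConv_toConv, convInverse_apply_of_le hΔ h0 (show l ≤ m by omega) hb]
    simp [convNil]

theorem convInverse_mem
    (hΔ : ∀ n, ∀ x ∈ 𝒜 n, comul (R := K) x ∈ tensorGrading 𝒜 n)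
    (hε : ∀ n, n ≠ 0 → ∀ x ∈ 𝒜 n, counit (R := K) x = 0)
    (n : ℕ) (x : A)
    (hx : x ∈ 𝒜 n) : convInverse 𝒜 x ∈ 𝒜 n := by
  have hone : ∀ k, ∀ a ∈ 𝒜 k, algebraMap K A (counit (R := K) a) ∈ 𝒜 k := by
    intro k a ha
    rcases eq_or_ne k 0 with rfl | hk
    · exact SetLike.algebraMap_mem_graded 𝒜 _
    · simp [hε k hk a ha]
  have hpow : ∀ m k, ∀ a ∈ 𝒜 k, (convNil K A ^ m).ofConv a ∈ 𝒜 k := by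
    intro m
    induction m with
    | zero => simpa using hone
    | succ m ih =>
      intro k a ha
      rw [pow_succ']
      exact conv_mem 𝒜 _ _ (hΔ k a ha) (fun k a ha => sub_mem (hone k a ha) ha) ih
  rw [convInverse_apply hx, ofConv_sum, LinearMap.sum_apply]
  exact sum_mem fun m _ => hpow m n x hx

end Antipode

section Dual

variable [HopfAlgebra K A] (𝒜 : ℕ → Submodule K A) [GradedAlgebra 𝒜] [IsGradedHopfAlgebra 𝒜]

/-- The graded dual `A^{*g}`: the linear forms that vanish on `A_n` for all large `n`. It is a
subalgebra of the convolution algebra of linear forms, so that `(fg)(x) = (f ⊗ g)(Δ(x))` and the unit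
is the counit of `A`. -/
def gradedDualSubalgebra : Subalgebra K (WithConv (A →ₗ[K] K)) where
  carrier := {f | ∃ n₀, ∀ n ≥ n₀, ∀ x ∈ 𝒜 n, f.ofConv x = 0}
  add_mem' := by
    rintro f g ⟨m, hf⟩ ⟨n, hg⟩
    refine ⟨max m n, fun k hk x hx => ?_⟩
    rw [ofConv_add, LinearMap.add_apply, hf k (le_of_max_le_left hk) x hx,
      hg k (le_of_max_le_right hk) x hx, add_zero]
  mul_mem' := by
    rintro f g ⟨m, hf⟩ ⟨n, hg⟩
    refine ⟨m + n, fun k hk x hx => ?_⟩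
    rw [conv_congr 𝒜 f g 0 0 (IsGradedHopfAlgebra.comul_mem k x hx)]
    · simp
    · intro i j a b hij ha hb
      by_cases hi : m ≤ i
      · simp [hf i hi a ha]
      · simp [hg j (by omega) b hb]
  algebraMap_mem' r := ⟨1, fun n hn x hx => by
    have := IsGradedHopfAlgebra.counit_eq_zero (K := K) (𝒜 := 𝒜) n (by omega) x hx
    simp [this]⟩

/-- The graded dual of a graded Hopf algebra, as a type. -/
def GradedDual : Type _ := gradedDualSubalgebra 𝒜

namespace GradedDual

variable {𝒜}

noncomputable instance : Ring (GradedDual 𝒜) := inferInstanceAs (Ring (gradedDualSubalgebra 𝒜))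

noncomputable instance : Algebra K (GradedDual 𝒜) :=
  inferInstanceAs (Algebra K (gradedDualSubalgebra 𝒜))

/-- The inclusion of the graded dual into the full dual. -/
def toDual : GradedDual 𝒜 →ₗ[K] Module.Dual K A where
  toFun f := f.1.ofConv
  map_add' _ _ := rfl
  map_smul' _ _ := rfl

theorem toDual_injective : Function.Injective (toDual (𝒜 := 𝒜)) := fun _ _ h =>
  Subtype.ext (WithConv.ext h)

theorem toDual_mul (f g : GradedDual 𝒜) (x : A) : toDual (f * g) x =
    LinearMap.mul' K K (TensorProduct.map (toDual f) (toDual g) (comul (R := K) x)) := rfl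

theorem toDual_one (x : A) : toDual (1 : GradedDual 𝒜) x = counit (R := K) x := rfl

/-- A linear form that vanishes on all components of large weight, as an element of the graded dual. -/
def ofDual (f : Module.Dual K A) (hf : ∃ n₀, ∀ n ≥ n₀, ∀ x ∈ 𝒜 n, f x = 0) : GradedDual 𝒜 :=
  ⟨toConv f, hf⟩

@[simp] theorem toDual_ofDual (f : Module.Dual K A) (hf : ∃ n₀, ∀ n ≥ n₀, ∀ x ∈ 𝒜 n, f x = 0) :
    toDual (ofDual f hf) = f := rfl

theorem exists_toDual (f : GradedDual 𝒜) : ∃ n₀, ∀ n ≥ n₀, ∀ x ∈ 𝒜 n, toDual f x = 0 := f.2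

variable (𝒜) in
/-- The homogeneous component of weight `n` of the graded dual: the linear forms that vanish on
`A_k` for all `k ≠ n`. -/
def grading (n : ℕ) : Submodule K (GradedDual 𝒜) where
  carrier := {f | ∀ k, k ≠ n → ∀ x ∈ 𝒜 k, toDual f x = 0}
  add_mem' hf hg k hk x hx := by
    rw [map_add, LinearMap.add_apply, hf k hk x hx, hg k hk x hx, add_zero]
  zero_mem' k hk x hx := by simp
  smul_mem' r f hf k hk x hx := by rw [map_smul, LinearMap.smul_apply, hf k hk x hx, smul_zero]

theorem dualDistrib_injective {M N V W : Type*} [AddCommGroup M] [Module K M] [AddCommGroup N]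
    [Module K N] [AddCommGroup V] [Module K V] [AddCommGroup W] [Module K W]
    {i : M →ₗ[K] Module.Dual K V} {j : N →ₗ[K] Module.Dual K W}
    (hi : Function.Injective i) (hj : Function.Injective j) :
    Function.Injective (TensorProduct.dualDistrib K V W ∘ₗ TensorProduct.map i j) := by
  rw [← LinearMap.ker_eq_bot, LinearMap.ker_eq_bot']
  classical
  intro z hz
  let b := Module.Basis.ofVectorSpace K N
  obtain ⟨c, rfl⟩ := (TensorProduct.equivFinsuppOfBasisRight (M := M) b).symm.surjective z
  rw [TensorProduct.equivFinsuppOfBasisRight_symm_apply] at hz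
  have h : ∀ x k, i (c k) x = 0 := by
    intro x
    have h1 : Finsupp.linearCombination K b (c.mapRange (fun m => i m x) (by simp)) = 0 := by
      apply hj
      ext y
      have := LinearMap.congr_fun hz (x ⊗ₜ y)
      rw [Finsupp.linearCombination_apply, Finsupp.sum_mapRange_index (by simp)]
      simpa [Finsupp.sum, map_sum, LinearMap.sum_apply] using this
    have h2 := (linearIndependent_iff.1 b.linearIndependent) _ h1
    intro k
    simpa using DFunLike.congr_fun h2 k
  have : c = 0 := by
    ext k
    exact hi (by rw [Finsupp.zero_apply, map_zero]; exact LinearMap.ext fun x => h x k)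
  rw [this, map_zero]

variable (𝒜) in
/-- `θ(f ⊗ g)(x ⊗ y) = f(x) g(y)`. -/
noncomputable def theta : GradedDual 𝒜 ⊗[K] GradedDual 𝒜 →ₗ[K] Module.Dual K (A ⊗[K] A) :=
  TensorProduct.dualDistrib K A A ∘ₗ TensorProduct.map toDual toDual

@[simp] theorem theta_tmul (f g : GradedDual 𝒜) (x y : A) :
    theta 𝒜 (f ⊗ₜ g) (x ⊗ₜ y) = toDual f x * toDual g y := by
  simp [theta]

theorem theta_injective : Function.Injective (theta 𝒜) :=
  dualDistrib_injective toDual_injective toDual_injective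

theorem toDual_comp_mul_mem_range (f : GradedDual 𝒜) :
    toDual f ∘ₗ LinearMap.mul' K A ∈ LinearMap.range (theta 𝒜) := by
  classical
  obtain ⟨N, hN⟩ := exists_toDual f
  have hfin := IsGradedHopfAlgebra.finite (K := K) (𝒜 := 𝒜)
  let b := fun k => Module.finBasis K (𝒜 k)
  let p : ∀ k, A →ₗ[K] 𝒜 k := fun k =>
    DirectSum.component K ℕ (fun i => 𝒜 i) k ∘ₗ (DirectSum.decomposeLinearEquiv 𝒜).toLinearMap
  have hp : ∀ k x, p k x = DirectSum.decompose 𝒜 x k := fun _ _ => rfl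
  let u : ∀ k, Fin (Module.finrank K (𝒜 k)) → GradedDual 𝒜 := fun k i =>
    ofDual ((b k).coord i ∘ₗ p k) ⟨k + 1, fun n hn x hx => by
      rw [LinearMap.comp_apply, hp, DirectSum.decompose_of_mem 𝒜 hx, DirectSum.of_eq_of_ne _ _ _
        (by omega), map_zero]⟩
  let v : ∀ k, Fin (Module.finrank K (𝒜 k)) → GradedDual 𝒜 := fun k i =>
    ofDual (toDual f ∘ₗ LinearMap.mulLeft K (b k i : A)) ⟨N, fun n hn x hx =>
      hN (k + n) (by omega) _ (SetLike.mul_mem_graded (b k i).2 hx)⟩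
  refine ⟨∑ k ∈ Finset.range N, ∑ i, u k i ⊗ₜ v k i, ?_⟩
  refine TensorProduct.ext' fun x y => ?_
  have hx : ∀ k, ∑ i, (b k).coord i (p k x) * toDual f ((b k i : A) * y) =
      toDual f ((p k x : A) * y) := by
    intro k
    have h := congrArg (fun z : 𝒜 k => toDual f ((z : A) * y)) ((b k).sum_repr (p k x))
    simpa [Finset.sum_mul, map_sum, -Module.Basis.sum_repr] using h
  simp only [map_sum, LinearMap.sum_apply, theta_tmul, u, v, toDual_ofDual, LinearMap.comp_apply,
    LinearMap.mulLeft_apply, LinearMap.mul'_apply]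
  rw [Finset.sum_congr rfl fun k _ => hx k]
  have hbig : ∀ k, N ≤ k → toDual f ((p k x : A) * y) = 0 := by
    intro k hk
    have : toDual f ∘ₗ LinearMap.mulLeft K (p k x : A) = 0 :=
      linearMap_ext_graded (𝒜 := 𝒜) fun n y hy =>
        hN (k + n) (by omega) _ (SetLike.mul_mem_graded (p k x).2 hy)
    exact LinearMap.congr_fun this y
  have hsum := DirectSum.sum_support_decompose 𝒜 x
  conv_rhs => rw [← hsum, Finset.sum_mul, map_sum]
  refine (Finset.sum_subset (Finset.subset_union_left
    (s₂ := DFinsupp.support (DirectSum.decompose 𝒜 x))) ?_).trans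
    (Finset.sum_subset (Finset.subset_union_right (s₁ := Finset.range N)) ?_).symm
  · intro k _ hk
    exact hbig k (by simpa using hk)
  · intro k _ hk
    rw [hp, DFinsupp.notMem_support_iff.1 hk]
    simp

variable (𝒜) in
/-- The transpose of the product, through the embedding `θ`: `Δ(f)(x ⊗ y) = f(xy)`. -/
noncomputable def comulDual : GradedDual 𝒜 →ₗ[K] GradedDual 𝒜 ⊗[K] GradedDual 𝒜 :=
  (LinearEquiv.ofInjective (theta 𝒜) theta_injective).symm.toLinearMap ∘ₗ
    LinearMap.codRestrict _ ((LinearMap.mul' K A).dualMap ∘ₗ toDual) toDual_comp_mul_mem_range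

@[simp] theorem theta_comulDual (f : GradedDual 𝒜) (x y : A) :
    theta 𝒜 (comulDual 𝒜 f) (x ⊗ₜ y) = toDual f (x * y) := by
  have h : theta 𝒜 (comulDual 𝒜 f) = toDual f ∘ₗ LinearMap.mul' K A :=
    congrArg Subtype.val (LinearEquiv.apply_symm_apply
      (LinearEquiv.ofInjective (theta 𝒜) theta_injective)
      ⟨toDual f ∘ₗ LinearMap.mul' K A, toDual_comp_mul_mem_range f⟩)
  rw [h]
  simp

theorem theta_comulDual' (f : GradedDual 𝒜) (z : A ⊗[K] A) :
    theta 𝒜 (comulDual 𝒜 f) z = toDual f (LinearMap.mul' K A z) := by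
  induction z with
  | zero => simp
  | tmul x y => simp
  | add z w hz hw => simp only [map_add, hz, hw]

variable (𝒜) in
/-- The transpose of the unit, `ε(f) = f(1)`. -/
noncomputable def counitDual : GradedDual 𝒜 →ₗ[K] K :=
  LinearMap.applyₗ (1 : A) ∘ₗ toDual

@[simp] theorem counitDual_apply (f : GradedDual 𝒜) : counitDual 𝒜 f = toDual f 1 := rfl

noncomputable instance : Coalgebra K (GradedDual 𝒜) where
  comul := comulDual 𝒜
  counit := counitDual 𝒜
  coassoc := by
    refine LinearMap.ext fun f => ?_
    apply dualDistrib_injective (toDual_injective (𝒜 := 𝒜)) (theta_injective (𝒜 := 𝒜))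
    refine TensorProduct.ext' fun x yz => ?_
    induction yz with
    | zero => simp
    | add z w hz hw => simp only [TensorProduct.tmul_add, map_add, hz, hw]
    | tmul y z =>
    have h0 : ∀ (v : GradedDual 𝒜 ⊗[K] GradedDual 𝒜) (g : GradedDual 𝒜),
        (TensorProduct.dualDistrib K A (A ⊗[K] A) ∘ₗ TensorProduct.map toDual (theta 𝒜))
          (TensorProduct.assoc K _ _ _ (v ⊗ₜ[K] g)) (x ⊗ₜ (y ⊗ₜ z)) =
        theta 𝒜 v (x ⊗ₜ y) * toDual g z := by
      intro v g
      induction v with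
      | zero => simp
      | tmul a b => simp [mul_assoc]
      | add v w hv hw =>
        simp only [TensorProduct.add_tmul, map_add, LinearMap.add_apply, hv, hw, add_mul]
    have h1 : ∀ w : GradedDual 𝒜 ⊗[K] GradedDual 𝒜,
        (TensorProduct.dualDistrib K A (A ⊗[K] A) ∘ₗ TensorProduct.map toDual (theta 𝒜))
          (TensorProduct.assoc K _ _ _ ((comulDual 𝒜).rTensor _ w)) (x ⊗ₜ (y ⊗ₜ z)) =
        theta 𝒜 w ((x * y) ⊗ₜ z) := by
      intro w
      induction w with
      | zero => simp
      | tmul a b => rw [LinearMap.rTensor_tmul, h0]; simp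
      | add v w hv hw => simp only [map_add, LinearMap.add_apply, hv, hw]
    have h2 : ∀ w : GradedDual 𝒜 ⊗[K] GradedDual 𝒜,
        (TensorProduct.dualDistrib K A (A ⊗[K] A) ∘ₗ TensorProduct.map toDual (theta 𝒜))
          ((comulDual 𝒜).lTensor _ w) (x ⊗ₜ (y ⊗ₜ z)) =
        theta 𝒜 w (x ⊗ₜ (y * z)) := by
      intro w
      induction w with
      | zero => simp
      | tmul a b => simp
      | add v w hv hw => simp only [map_add, LinearMap.add_apply, hv, hw]
    refine (h1 _).trans (Eq.trans ?_ (h2 _).symm)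
    simp [mul_assoc]
  rTensor_counit_comp_comul := by
    refine LinearMap.ext fun f => (TensorProduct.lid K _).injective (toDual_injective ?_)
    refine LinearMap.ext fun x => ?_
    have h : ∀ w : GradedDual 𝒜 ⊗[K] GradedDual 𝒜,
        toDual (TensorProduct.lid K _ ((counitDual 𝒜).rTensor _ w)) x = theta 𝒜 w (1 ⊗ₜ x) := by
      intro w
      induction w with
      | zero => simp
      | tmul a b => simp
      | add v w hv hw => simp only [map_add, LinearMap.add_apply, hv, hw]
    exact (h _).trans (by simp)
  lTensor_counit_comp_comul := by
    refine LinearMap.ext fun f => (TensorProduct.rid K _).injective (toDual_injective ?_)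
    refine LinearMap.ext fun x => ?_
    have h : ∀ w : GradedDual 𝒜 ⊗[K] GradedDual 𝒜,
        toDual (TensorProduct.rid K _ ((counitDual 𝒜).lTensor _ w)) x = theta 𝒜 w (x ⊗ₜ 1) := by
      intro w
      induction w with
      | zero => simp
      | tmul a b => simp [mul_comm]
      | add v w hv hw => simp only [map_add, LinearMap.add_apply, hv, hw]
    exact (h _).trans (by simp)

theorem theta_mul (v w : GradedDual 𝒜 ⊗[K] GradedDual 𝒜) (x y : A) :
    theta 𝒜 (v * w) (x ⊗ₜ y) = LinearMap.mul' K K (TensorProduct.map (theta 𝒜 v) (theta 𝒜 w)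
      (TensorProduct.tensorTensorTensorComm K A A A A
        (comul (R := K) x ⊗ₜ comul (R := K) y))) := by
  induction v with
  | zero => simp
  | add v v' hv hv' =>
    simp only [add_mul, map_add, LinearMap.add_apply, hv, hv', TensorProduct.map_add_left]
  | tmul f g =>
  induction w with
  | zero => simp
  | add v v' hv hv' =>
    simp only [mul_add, map_add, LinearMap.add_apply, hv, hv', TensorProduct.map_add_right]
  | tmul f' g' =>
  rw [Algebra.TensorProduct.tmul_mul_tmul, theta_tmul, toDual_mul, toDual_mul]
  generalize comul (R := K) x = p
  generalize comul (R := K) y = q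
  induction p with
  | zero => simp
  | add v v' hv hv' => simp only [add_mul, map_add, TensorProduct.add_tmul, hv, hv']
  | tmul a b =>
  induction q with
  | zero => simp
  | add v v' hv hv' => simp only [mul_add, map_add, TensorProduct.tmul_add, hv, hv']
  | tmul c e =>
    simp
    ring

noncomputable instance : Bialgebra K (GradedDual 𝒜) :=
  Bialgebra.mk' K (GradedDual 𝒜)
    (by
      change toDual (1 : GradedDual 𝒜) 1 = 1
      simp [toDual_one])
    (by
      intro f g
      change toDual (f * g) 1 = toDual f 1 * toDual g 1
      simp [toDual_mul, Algebra.TensorProduct.one_def])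
    (by
      apply theta_injective
      refine TensorProduct.ext' fun x y => ?_
      rw [Algebra.TensorProduct.one_def]
      refine (theta_comulDual _ _ _).trans ?_
      simp [toDual_one])
    (by
      intro f g
      apply theta_injective
      refine TensorProduct.ext' fun x y => ?_
      refine (theta_comulDual _ _ _).trans ((theta_mul _ _ _ _).trans ?_).symm
      change LinearMap.mul' K K (TensorProduct.map (theta 𝒜 (comulDual 𝒜 f))
        (theta 𝒜 (comulDual 𝒜 g)) _) = _
      rw [toDual_mul, Bialgebra.comul_mul]
      generalize comul (R := K) x = p
      generalize comul (R := K) y = q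
      induction p with
      | zero => simp
      | add v v' hv hv' => simp only [add_mul, map_add, TensorProduct.add_tmul, hv, hv']
      | tmul a b =>
      induction q with
      | zero => simp
      | add v v' hv hv' => simp only [mul_add, map_add, TensorProduct.tmul_add, hv, hv']
      | tmul c e => simp)

variable (𝒜) in
/-- The transpose of the antipode. -/
noncomputable def antipodeDual : GradedDual 𝒜 →ₗ[K] GradedDual 𝒜 where
  toFun f := ofDual (toDual f ∘ₗ antipode K) <| by
    obtain ⟨n₀, h⟩ := exists_toDual f
    exact ⟨n₀, fun n hn x hx => h n hn _ (IsGradedHopfAlgebra.antipode_mem n x hx)⟩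
  map_add' _ _ := rfl
  map_smul' _ _ := rfl

theorem toDual_antipodeDual (f : GradedDual 𝒜) (x : A) :
    toDual (antipodeDual 𝒜 f) x = toDual f (antipode K x) := rfl

noncomputable instance : HopfAlgebra K (GradedDual 𝒜) where
  antipode := antipodeDual 𝒜
  mul_antipode_rTensor_comul := by
    refine LinearMap.ext fun f => toDual_injective (LinearMap.ext fun x => ?_)
    have h : ∀ w : GradedDual 𝒜 ⊗[K] GradedDual 𝒜,
        toDual (LinearMap.mul' K _ ((antipodeDual 𝒜).rTensor _ w)) x =
          theta 𝒜 w ((antipode K).rTensor A (comul (R := K) x)) := by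
      intro w
      induction w with
      | zero => simp
      | add v w hv hw => simp only [map_add, LinearMap.add_apply, hv, hw]
      | tmul a b =>
        rw [LinearMap.rTensor_tmul, LinearMap.mul'_apply, toDual_mul]
        generalize comul (R := K) x = p
        induction p with
        | zero => simp
        | add v v' hv hv' => simp only [map_add, hv, hv']
        | tmul a b => simp [toDual_antipodeDual]
    refine (h _).trans ((theta_comulDual' f _).trans ?_)
    rw [HopfAlgebra.mul_antipode_rTensor_comul_apply, Algebra.algebraMap_eq_smul_one, map_smul]
    change _ = toDual (algebraMap K (GradedDual 𝒜) (toDual f 1)) x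
    rw [Algebra.algebraMap_eq_smul_one, map_smul, LinearMap.smul_apply, toDual_one]
    simp [mul_comm]
  mul_antipode_lTensor_comul := by
    refine LinearMap.ext fun f => toDual_injective (LinearMap.ext fun x => ?_)
    have h : ∀ w : GradedDual 𝒜 ⊗[K] GradedDual 𝒜,
        toDual (LinearMap.mul' K _ ((antipodeDual 𝒜).lTensor _ w)) x =
          theta 𝒜 w ((antipode K).lTensor A (comul (R := K) x)) := by
      intro w
      induction w with
      | zero => simp
      | add v w hv hw => simp only [map_add, LinearMap.add_apply, hv, hw]
      | tmul a b =>
        rw [LinearMap.lTensor_tmul, LinearMap.mul'_apply, toDual_mul]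
        generalize comul (R := K) x = p
        induction p with
        | zero => simp
        | add v v' hv hv' => simp only [map_add, hv, hv']
        | tmul a b => simp [toDual_antipodeDual]
    refine (h _).trans ((theta_comulDual' f _).trans ?_)
    rw [HopfAlgebra.mul_antipode_lTensor_comul_apply, Algebra.algebraMap_eq_smul_one, map_smul]
    change _ = toDual (algebraMap K (GradedDual 𝒜) (toDual f 1)) x
    rw [Algebra.algebraMap_eq_smul_one, map_smul, LinearMap.smul_apply, toDual_one]
    simp [mul_comm]

variable (𝒜) in
/-- `γ` is homogeneous of degree `k`: it maps the component of weight `n` into the component of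
weight `n + k`, which is zero if `n + k < 0`. -/
def IsHomogeneousOfDegree (γ : A →ₗ[K] A) (k : ℤ) : Prop :=
  ∀ n, ∀ x ∈ 𝒜 n, (∃ m : ℕ, (m : ℤ) = n + k ∧ γ x ∈ 𝒜 m) ∨ γ x = 0

/-- The transpose `γ^{*g}(f) = f ∘ γ` of a homogeneous linear map. -/
noncomputable def transpose (γ : A →ₗ[K] A) {k : ℤ} (hγ : IsHomogeneousOfDegree 𝒜 γ k) :
    GradedDual 𝒜 →ₗ[K] GradedDual 𝒜 where
  toFun f := ofDual (toDual f ∘ₗ γ) <| by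
    obtain ⟨n₀, h⟩ := exists_toDual f
    refine ⟨n₀ + k.natAbs, fun n hn x hx => ?_⟩
    rcases hγ n x hx with ⟨m, hm, hmem⟩ | h0
    · exact h m (by omega) _ hmem
    · rw [LinearMap.comp_apply, h0, map_zero]
  map_add' _ _ := rfl
  map_smul' _ _ := rfl

end GradedDual

end Dual

end GradedDual

/-- Planar rooted trees decorated by `D`: a root with its decoration and the (ordered) list of the
subtrees grafted on it. Planar forests are lists of such trees. -/
inductive PTree (D : Type*) : Type _
  | node : D → List (PTree D) → PTree D

namespace PTree

variable {D : Type*}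

mutual

/-- The edges of a tree. An edge is identified with its upper end, so the edges of a tree are the
vertices of the forest obtained by deleting the root. -/
def Edge : PTree D → Type
  | node _ ts => ForestVertex ts

/-- The vertices of a forest `t :: ts`: the root of `t` (`none`), the other vertices of `t`
(which correspond to the edges of `t`), and the vertices of `ts`. -/
def ForestVertex : List (PTree D) → Type
  | [] => Empty
  | t :: ts => Option (Edge t) ⊕ ForestVertex ts

end

mutual

/-- The weight of a tree is its number of vertices. -/
def weight : PTree D → ℕ
  | node _ ts => weightForest ts + 1

/-- The weight of a forest is the sum of the weights of its trees. -/
def weightForest : List (PTree D) → ℕ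
  | [] => 0
  | t :: ts => weight t + weightForest ts

end

mutual

theorem finite_edge : (t : PTree D) → Finite (Edge t)
  | node _ ts => finite_forestVertex ts

theorem finite_forestVertex : (ts : List (PTree D)) → Finite (ForestVertex ts)
  | [] => inferInstanceAs (Finite Empty)
  | t :: ts =>
    have := finite_edge t
    have := finite_forestVertex ts
    inferInstanceAs (Finite (Option (Edge t) ⊕ ForestVertex ts))

end

noncomputable instance (t : PTree D) : Fintype (Edge t) :=
  have := finite_edge t
  Fintype.ofFinite _

mutual

/-- `Below t e e'` : the edges `e` and `e'` of `t` are distinct and `e` lies on the path from the root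
to `e'`, that is, some path of the oriented graph `t` runs through `e` and later through `e'`. -/
def Below : (t : PTree D) → Edge t → Edge t → Prop
  | node _ ts, e, e' => ForestBelow ts e e'

/-- The vertex `v` is a proper ancestor of the vertex `v'` in the forest. -/
def ForestBelow : (ts : List (PTree D)) → ForestVertex ts → ForestVertex ts → Prop
  | [], _, _ => False
  | _ :: _, .inl none, .inl (some _) => True
  | t :: _, .inl (some e), .inl (some e') => Below t e e'
  | _ :: ts, .inr v, .inr v' => ForestBelow ts v v'
  | _ :: _, _, _ => False

end

mutual

/-- `R^c(t)`: the connected component of the root after the cut `c`; the cut is given by the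
indicator function of the set of cut edges. -/
def trunk : (t : PTree D) → (Edge t → Bool) → PTree D
  | node d ts, c => node d (trunkForest ts c)

/-- The part of a forest that stays connected to the ground when, for each vertex `v` with
`c v = true`, the edge below `v` is cut. -/
def trunkForest : (ts : List (PTree D)) → (ForestVertex ts → Bool) → List (PTree D)
  | [], _ => []
  | t :: ts, c =>
    (bif c (.inl none) then [] else [trunk t fun e => c (.inl (some e))]) ++
      trunkForest ts fun v => c (.inr v)

end

mutual

/-- `P^c(t)`: the planar forest of the other components after the admissible cut `c`. -/
def pruned : (t : PTree D) → (Edge t → Bool) → List (PTree D)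
  | node _ ts, c => prunedForest ts c

/-- The planar forest that falls off when, for each vertex `v` with `c v = true`, the edge below `v`
is cut. -/
def prunedForest : (ts : List (PTree D)) → (ForestVertex ts → Bool) → List (PTree D)
  | [], _ => []
  | t :: ts, c =>
    (bif c (.inl none) then [t] else pruned t fun e => c (.inl (some e))) ++
      prunedForest ts fun v => c (.inr v)

end


/-- An admissible cut: a nonempty set of edges such that every path meets at most one of them. -/
def IsAdmissible (t : PTree D) (c : Edge t → Bool) : Prop :=
  (∃ e, c e = true) ∧ ∀ e e', c e = true → c e' = true → ¬ Below t e e'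

mutual

theorem induction {p : PTree D → Prop} (h : ∀ d ts, (∀ t ∈ ts, p t) → p (node d ts)) :
    (t : PTree D) → p t
  | node d ts => h d ts (forest_induction h ts)

theorem forest_induction {p : PTree D → Prop} (h : ∀ d ts, (∀ t ∈ ts, p t) → p (node d ts)) :
    (ts : List (PTree D)) → ∀ t ∈ ts, p t
  | [] => by simp
  | t :: ts => List.forall_mem_cons.2 ⟨induction h t, forest_induction h ts⟩

end

end PTree

/-- The free (noncommutative) `ℚ`-algebra generated by the planar rooted trees decorated by `D`. -/
abbrev HPR (D : Type*) : Type _ := FreeAlgebra ℚ (PTree D)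

namespace HPR

open PTree Finset

variable {D : Type*}

/-- A tree, as an element of the algebra. -/
noncomputable def tree (t : PTree D) : HPR D := FreeAlgebra.ι ℚ t

/-- A forest `t₁ … tₙ`, as the monomial in the algebra. -/
noncomputable def forest (F : List (PTree D)) : HPR D := (F.map tree).prod

open Classical in
/-- `Δ(t) = t ⊗ 1 + 1 ⊗ t + ∑ P^c(t) ⊗ R^c(t)`, the sum being over the admissible cuts of `t`. -/
noncomputable def comulTree (t : PTree D) : HPR D ⊗[ℚ] HPR D :=
  tree t ⊗ₜ 1 + 1 ⊗ₜ tree t +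
    ∑ c : Edge t → Bool with IsAdmissible t c, forest (pruned t c) ⊗ₜ tree (trunk t c)

/-- The coproduct: a cut of a forest `t₁ … tₙ` is a tuple of cuts (admissible, empty or total) of the
`tᵢ`, so that `Δ(t₁ … tₙ) = Δ(t₁) … Δ(tₙ)`. -/
noncomputable def comulHom (D : Type*) : HPR D →ₐ[ℚ] HPR D ⊗[ℚ] HPR D :=
  FreeAlgebra.lift ℚ comulTree

/-- The counit: it sends `1` to `1` and every nonempty forest to `0`. -/
noncomputable def counitHom (D : Type*) : HPR D →ₐ[ℚ] ℚ :=
  FreeAlgebra.lift ℚ fun _ => 0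

/-- The basis of forests; its value at `F` is `forest F`, see `forestBasis_apply`. -/
noncomputable def forestBasis (D : Type*) : Module.Basis (List (PTree D)) ℚ (HPR D) :=
  (FreeAlgebra.basisFreeMonoid ℚ (PTree D)).reindex FreeMonoid.toList

theorem forestBasis_apply (F : List (PTree D)) : forestBasis D F = forest F := by
  have h : ∀ G : FreeMonoid (PTree D), FreeAlgebra.equivMonoidAlgebraFreeMonoid.symm
      (MonoidAlgebra.of ℚ (FreeMonoid (PTree D)) G) = forest G.toList := by
    intro G
    induction G using FreeMonoid.inductionOn' with
    | one => rw [map_one, map_one]; rfl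
    | of_mul x xs ih =>
      rw [map_mul, map_mul, ih]
      simp [forest, tree, FreeAlgebra.equivMonoidAlgebraFreeMonoid]
  simpa [forestBasis, FreeAlgebra.basisFreeMonoid] using! h (FreeMonoid.ofList F)

/-- `B_d^+`: the linear map that grafts the trees of a forest on a common root decorated by `d`. -/
noncomputable def graft (d : D) : HPR D →ₗ[ℚ] HPR D :=
  (forestBasis D).constr ℚ fun F => tree (node d F)

open Classical in
/-- `γ_d` deletes the last tree of a forest if this tree is the single vertex decorated by `d`, and
sends all other forests (the empty one included) to `0`. -/
noncomputable def gamma (d : D) : HPR D →ₗ[ℚ] HPR D :=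
  (forestBasis D).constr ℚ fun F =>
    if F.getLast? = some (node d []) then forest F.dropLast else 0

theorem graft_forest (d : D) (F : List (PTree D)) : graft d (forest F) = tree (node d F) := by
  rw [graft, ← forestBasis_apply, Module.Basis.constr_basis]

@[simp] theorem forest_nil : forest ([] : List (PTree D)) = 1 := rfl

@[simp] theorem forest_cons (t : PTree D) (F : List (PTree D)) :
    forest (t :: F) = tree t * forest F := by simp [forest]

@[simp] theorem forest_append (F G : List (PTree D)) :
    forest (F ++ G) = forest F * forest G := by simp [forest]

@[simp] theorem comulHom_tree (t : PTree D) : comulHom D (tree t) = comulTree t := by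
  simp [comulHom, tree]

@[simp] theorem counitHom_tree (t : PTree D) : counitHom D (tree t) = 0 := by
  simp [counitHom, tree]

mutual

theorem trunk_empty : (t : PTree D) → trunk t (fun _ => false) = t
  | node d ts => congrArg (node d) (trunkForest_empty ts)

theorem trunkForest_empty : (ts : List (PTree D)) → trunkForest ts (fun _ => false) = ts
  | [] => rfl
  | t :: ts => congrArg₂ List.cons (trunk_empty t) (trunkForest_empty ts)

end

mutual

theorem pruned_empty : (t : PTree D) → pruned t (fun _ => false) = []
  | node _ ts => prunedForest_empty ts

theorem prunedForest_empty : (ts : List (PTree D)) → prunedForest ts (fun _ => false) = []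
  | [] => rfl
  | t :: ts => congrArg₂ (· ++ ·) (pruned_empty t) (prunedForest_empty ts)

end

open Classical in
theorem comulTree_eq (t : PTree D) : comulTree t = tree t ⊗ₜ 1 +
    ∑ c : Edge t → Bool, if (∀ e e', c e = true → c e' = true → ¬ Below t e e') then
      forest (pruned t c) ⊗ₜ[ℚ] tree (trunk t c) else 0 := by
  rw [comulTree, add_assoc]
  congr 1
  rw [← Finset.add_sum_erase _ _ (Finset.mem_univ (fun _ => false)), if_pos (by simp),
    trunk_empty, pruned_empty, forest_nil]
  congr 1
  rw [← Finset.sum_filter]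
  refine Finset.sum_congr ?_ fun _ _ => rfl
  ext c
  rw [Finset.mem_filter, Finset.mem_filter, Finset.mem_erase]
  simp [IsAdmissible, funext_iff]

noncomputable instance (ts : List (PTree D)) : Fintype (ForestVertex ts) :=
  have := finite_forestVertex ts
  Fintype.ofFinite _

/-- A cut of the forest `t :: ts` amounts to the choice whether the root of `t` is cut off, and cuts of
`t` and `ts`. -/
def cutEquiv (t : PTree D) (ts : List (PTree D)) :
    (ForestVertex (t :: ts) → Bool) ≃ (Bool × (Edge t → Bool)) × (ForestVertex ts → Bool) where
  toFun c := ((c (.inl none), fun e => c (.inl (some e))), fun v => c (.inr v))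
  invFun p := Sum.elim (fun o => o.elim p.1.1 p.1.2) p.2
  left_inv c := by
    funext v
    rcases v with (_ | e) | v <;> rfl
  right_inv p := rfl

theorem antichain_cons (t : PTree D) (ts : List (PTree D)) (c : ForestVertex (t :: ts) → Bool) :
    (∀ v v', c v = true → c v' = true → ¬ ForestBelow (t :: ts) v v') ↔
      ((c (.inl none) = true → ∀ e, c (.inl (some e)) = false) ∧
        ∀ e e', c (.inl (some e)) = true → c (.inl (some e')) = true → ¬ Below t e e') ∧
      ∀ v v', c (.inr v) = true → c (.inr v') = true → ¬ ForestBelow ts v v' := by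
  constructor
  · intro h
    refine ⟨⟨fun h0 e => ?_, fun e e' he he' hb => h _ _ he he' hb⟩,
      fun v v' hv hv' hb => h _ _ hv hv' hb⟩
    by_contra h1
    exact h (.inl none) (.inl (some e)) h0 (by simpa using h1) trivial
  · rintro ⟨⟨h1, h2⟩, h3⟩ v v' hv hv' hb
    rcases v with (_ | e) | v <;> rcases v' with (_ | e') | v'
    · exact hb
    · simp [h1 hv e'] at hv'
    · exact hb
    · exact hb
    · exact h2 _ _ hv hv' hb
    · exact hb
    · exact hb
    · exact hb
    · exact h3 _ _ hv hv' hb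

open Classical in
theorem sum_forest_cuts : (ts : List (PTree D)) →
    (∑ c : ForestVertex ts → Bool,
      if (∀ v v', c v = true → c v' = true → ¬ ForestBelow ts v v') then
        forest (prunedForest ts c) ⊗ₜ[ℚ] forest (trunkForest ts c) else 0) = comulHom D (forest ts)
  | [] => by
    rw [forest_nil, map_one, Finset.sum_eq_single (fun _ => false)]
    · rw [if_pos (by simp)]; rfl
    · intro b _ hb
      exact absurd (funext fun v => Empty.elim v) hb
    · simp
  | t :: ts => by
    rw [forest_cons, map_mul, ← sum_forest_cuts ts, comulHom_tree, comulTree_eq,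
      ← Equiv.sum_comp (cutEquiv t ts).symm, Fintype.sum_prod_type, Fintype.sum_prod_type,
      Fintype.sum_bool, add_mul, Finset.sum_mul_sum]
    congr 1
    · rw [Finset.sum_eq_single (fun _ => false)]
      · rw [Finset.mul_sum]
        refine Finset.sum_congr rfl fun c _ => ?_
        rw [mul_ite, mul_zero]
        refine if_congr ?_ ?_ rfl
        · rw [antichain_cons]
          change ((true = true → ∀ _ : Edge t, false = false) ∧
            ∀ e e' : Edge t, false = true → false = true → ¬ Below t e e') ∧
            (∀ v v', c v = true → c v' = true → ¬ ForestBelow ts v v') ↔ _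
          simp
        · change forest ([t] ++ prunedForest ts c) ⊗ₜ forest ([] ++ trunkForest ts c) = _
          simp
      · intro b _ hb
        refine Finset.sum_eq_zero fun c _ => if_neg ?_
        rw [antichain_cons]
        rintro ⟨⟨h, -⟩, -⟩
        exact hb (funext fun e => h rfl e)
      · simp
    · refine Finset.sum_congr rfl fun b _ => Finset.sum_congr rfl fun c _ => ?_
      rw [ite_zero_mul_ite_zero]
      refine if_congr ?_ ?_ rfl
      · rw [antichain_cons]
        change ((false = true → ∀ e : Edge t, b e = false) ∧
          ∀ e e' : Edge t, b e = true → b e' = true → ¬ Below t e e') ∧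
          (∀ v v', c v = true → c v' = true → ¬ ForestBelow ts v v') ↔ _
        simp
      · change forest (pruned t b ++ prunedForest ts c) ⊗ₜ
          forest ([trunk t b] ++ trunkForest ts c) = _
        simp

theorem comulHom_graft (d : D) (x : HPR D) :
    comulHom D (graft d x) = graft d x ⊗ₜ 1 + (graft d).lTensor (HPR D) (comulHom D x) := by
  have h : (comulHom D).toLinearMap ∘ₗ graft d =
      (TensorProduct.mk ℚ (HPR D) (HPR D)).flip 1 ∘ₗ graft d +
        (graft d).lTensor (HPR D) ∘ₗ (comulHom D).toLinearMap := by
    classical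
    refine (forestBasis D).ext fun F => ?_
    have h : comulHom D (forest F) = _ := (sum_forest_cuts F).symm
    simp only [LinearMap.comp_apply, LinearMap.add_apply, AlgHom.toLinearMap_apply,
      forestBasis_apply, graft_forest, comulHom_tree, comulTree_eq, h, map_sum]
    refine congrArg₂ (· + ·) rfl ?_
    refine Fintype.sum_congr _ _ fun c => ?_
    rw [apply_ite ((graft d).lTensor (HPR D)), map_zero, LinearMap.lTensor_tmul, graft_forest]
    rfl
  exact LinearMap.congr_fun h x

theorem counitHom_graft (d : D) (x : HPR D) : counitHom D (graft d x) = 0 := by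
  have h : (counitHom D).toLinearMap ∘ₗ graft d = 0 :=
    (forestBasis D).ext fun F => by simp [forestBasis_apply, graft_forest]
  exact LinearMap.congr_fun h x

theorem algHom_ext_graft {B : Type*} [Semiring B] [Algebra ℚ B] {f g : HPR D →ₐ[ℚ] B}
    (h : ∀ d x, f x = g x → f (graft d x) = g (graft d x)) : f = g := by
  refine FreeAlgebra.hom_ext (funext fun t => ?_)
  change f (tree t) = g (tree t)
  induction t using PTree.induction with
  | _ d ts ih =>
    rw [← graft_forest]
    refine h d _ ?_
    rw [forest, map_list_prod, map_list_prod, List.map_map, List.map_map]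
    exact congrArg List.prod (List.map_congr_left ih)

noncomputable instance : Bialgebra ℚ (HPR D) :=
  Bialgebra.ofAlgHom (comulHom D) (counitHom D)
    (by
      refine algHom_ext_graft fun d x hx => ?_
      have h0 : ∀ (z : HPR D ⊗[ℚ] HPR D) (b : HPR D),
          Algebra.TensorProduct.assoc ℚ ℚ ℚ (HPR D) (HPR D) (HPR D) (z ⊗ₜ graft d b) =
          ((graft d).lTensor (HPR D)).lTensor (HPR D)
            (Algebra.TensorProduct.assoc ℚ ℚ ℚ (HPR D) (HPR D) (HPR D) (z ⊗ₜ b)) := by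
        intro z b
        induction z with
        | zero => simp
        | tmul a c => simp
        | add z w hz hw => simp only [TensorProduct.add_tmul, map_add, hz, hw]
      have h1 : ∀ y : HPR D ⊗[ℚ] HPR D, Algebra.TensorProduct.assoc ℚ ℚ ℚ (HPR D) (HPR D) (HPR D)
          (Algebra.TensorProduct.map (comulHom D) (.id ℚ (HPR D))
            ((graft d).lTensor (HPR D) y)) =
          ((graft d).lTensor (HPR D)).lTensor (HPR D)
            (Algebra.TensorProduct.assoc ℚ ℚ ℚ (HPR D) (HPR D) (HPR D)
              (Algebra.TensorProduct.map (comulHom D) (.id ℚ (HPR D)) y)) := by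
        intro y
        induction y with
        | zero => simp
        | tmul a b => simp [h0]
        | add z w hz hw => simp only [map_add, hz, hw]
      have h2 : ∀ y : HPR D ⊗[ℚ] HPR D, Algebra.TensorProduct.map (.id ℚ (HPR D)) (comulHom D)
          ((graft d).lTensor (HPR D) y) =
          Algebra.TensorProduct.assoc ℚ ℚ ℚ (HPR D) (HPR D) (HPR D)
            ((graft d).lTensor (HPR D) y ⊗ₜ 1) +
          ((graft d).lTensor (HPR D)).lTensor (HPR D)
            (Algebra.TensorProduct.map (.id ℚ (HPR D)) (comulHom D) y) := by
        intro y
        induction y with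
        | zero => simp
        | tmul a b => simp [comulHom_graft, TensorProduct.tmul_add]
        | add z w hz hw =>
          simp only [map_add, hz, hw, TensorProduct.add_tmul]
          abel
      simp only [AlgHom.comp_apply] at hx ⊢
      replace hx : Algebra.TensorProduct.assoc ℚ ℚ ℚ (HPR D) (HPR D) (HPR D)
        (Algebra.TensorProduct.map (comulHom D) (.id ℚ (HPR D)) (comulHom D x)) = _ := hx
      change Algebra.TensorProduct.assoc ℚ ℚ ℚ (HPR D) (HPR D) (HPR D)
        (Algebra.TensorProduct.map (comulHom D) (.id ℚ (HPR D)) (comulHom D (graft d x))) = _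
      simp only [comulHom_graft, map_add, h1, h2, hx, Algebra.TensorProduct.map_tmul,
        TensorProduct.add_tmul, map_one, AlgHom.id_apply]
      simp [Algebra.TensorProduct.one_def, add_assoc])
    (by
      refine algHom_ext_graft fun d x hx => ?_
      have h1 : ∀ y : HPR D ⊗[ℚ] HPR D, Algebra.TensorProduct.map (counitHom D) (.id ℚ (HPR D))
          ((graft d).lTensor (HPR D) y) = (graft d).lTensor ℚ
            (Algebra.TensorProduct.map (counitHom D) (.id ℚ (HPR D)) y) := by
        intro y
        induction y with
        | zero => simp
        | tmul a b => simp
        | add z w hz hw => simp only [map_add, hz, hw]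
      simp only [AlgHom.comp_apply] at hx ⊢
      rw [comulHom_graft, map_add, h1, hx]
      simp [counitHom_graft])
    (by
      refine algHom_ext_graft fun d x hx => ?_
      have h1 : ∀ y : HPR D ⊗[ℚ] HPR D, Algebra.TensorProduct.map (.id ℚ (HPR D)) (counitHom D)
          ((graft d).lTensor (HPR D) y) = 0 := by
        intro y
        induction y with
        | zero => simp
        | tmul a b => simp [counitHom_graft]
        | add z w hz hw => simp only [map_add, hz, hw, add_zero]
      rw [AlgHom.comp_apply, comulHom_graft, map_add, h1]
      simp)

theorem comul_eq (x : HPR D) : Coalgebra.comul (R := ℚ) x = comulHom D x := rfl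

theorem counit_eq (x : HPR D) : Coalgebra.counit (R := ℚ) x = counitHom D x := rfl

theorem weightForest_append (F G : List (PTree D)) :
    weightForest (F ++ G) = weightForest F + weightForest G := by
  induction F with
  | nil => simp [weightForest]
  | cons t F ih => simp [weightForest, ih, add_assoc]

/-- The homogeneous component of weight `n`: the span of the forests of weight `n`. -/
def weightGrading (D : Type*) (n : ℕ) : Submodule ℚ (HPR D) :=
  Submodule.span ℚ (forest '' {F : List (PTree D) | weightForest F = n})

theorem forest_mem (F : List (PTree D)) : forest F ∈ weightGrading D (weightForest F) :=
  Submodule.subset_span ⟨F, rfl, rfl⟩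

theorem tree_mem (t : PTree D) : tree t ∈ weightGrading D (weight t) := by
  simpa [weightForest] using forest_mem [t]

instance : SetLike.GradedMonoid (weightGrading D) where
  one_mem := forest_mem []
  mul_mem i j x y hx hy := by
    have h : weightGrading D i * weightGrading D j ≤ weightGrading D (i + j) := by
      rw [weightGrading, weightGrading, Submodule.span_mul_span, Submodule.span_le]
      rintro _ ⟨_, ⟨F, rfl, rfl⟩, _, ⟨G, rfl, rfl⟩, rfl⟩
      change forest F * forest G ∈ _
      rw [← forest_append, ← weightForest_append]
      exact forest_mem _
    exact h (Submodule.mul_mem_mul hx hy)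

noncomputable instance : GradedAlgebra (weightGrading D) :=
  GradedAlgebra.ofAlgHom _
    (FreeAlgebra.lift ℚ fun t => DirectSum.of (fun i => weightGrading D i) (weight t)
      ⟨tree t, tree_mem t⟩)
    (by
      ext t
      simp [tree])
    (by
      rintro i ⟨x, hx⟩
      simp only
      induction hx using Submodule.span_induction with
      | zero => rw [map_zero]; exact (map_zero _).symm
      | add x y hx hy ihx ihy =>
        rw [map_add, ihx, ihy, ← map_add]
        rfl
      | smul a x hx ih =>
        rw [map_smul, ih]
        exact ((DirectSum.lof ℚ ℕ (fun i => weightGrading D i) i).map_smul a ⟨x, hx⟩).symm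
      | mem x hx =>
        obtain ⟨F, rfl, rfl⟩ := hx
        induction F with
        | nil => simp only [forest_nil, map_one]; rfl
        | cons t F ih =>
          have ht : FreeAlgebra.lift ℚ (fun t => DirectSum.of (fun i => weightGrading D i) (weight t)
              ⟨tree t, tree_mem t⟩) (tree t) = DirectSum.of (fun i => weightGrading D i) (weight t)
              ⟨tree t, tree_mem t⟩ := FreeAlgebra.lift_ι_apply _ _
          simp only [forest_cons, map_mul, ih, ht, DirectSum.of_mul_of]
          rfl)

mutual

theorem weight_cut : (t : PTree D) → (c : Edge t → Bool) →
    weightForest (pruned t c) + weight (trunk t c) = weight t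
  | node _ ts, c => congrArg (· + 1) (weightForest_cut ts c)

theorem weightForest_cut : (ts : List (PTree D)) → (c : ForestVertex ts → Bool) →
    weightForest (prunedForest ts c) + weightForest (trunkForest ts c) = weightForest ts
  | [], _ => rfl
  | t :: ts, c => by
    have h1 := weight_cut t fun e => c (.inl (some e))
    have h2 := weightForest_cut ts fun v => c (.inr v)
    rw [prunedForest, trunkForest, weightForest_append, weightForest_append]
    cases c (.inl none) <;> simp [weightForest] <;> omega

end

theorem finite_weight [Finite D] (n : ℕ) : {F : List (PTree D) | weightForest F ≤ n}.Finite := by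
  induction n with
  | zero =>
    refine (Set.finite_singleton []).subset fun F hF => ?_
    rcases F with _ | ⟨⟨d, G⟩, F⟩
    · rfl
    · simp [weightForest, weight] at hF
  | succ n ih =>
    refine ((Set.finite_singleton []).union (((Set.finite_univ (α := D)).prod (ih.prod ih)).image
      fun p => node p.1 p.2.1 :: p.2.2)).subset fun F hF => ?_
    rcases F with _ | ⟨⟨d, G⟩, F⟩
    · exact Or.inl rfl
    · simp only [weightForest, weight, Set.mem_ofPred_eq] at hF
      exact Or.inr ⟨(d, G, F), ⟨trivial, by simp; omega, by simp; omega⟩, rfl⟩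

instance [Finite D] (n : ℕ) : FiniteDimensional ℚ (weightGrading D n) :=
  FiniteDimensional.span_of_finite ℚ
    (((finite_weight n).subset fun _ h => le_of_eq h).image _)

theorem tensorGrading_mul_mem {m n : ℕ} {z w : HPR D ⊗[ℚ] HPR D}
    (hz : z ∈ tensorGrading (weightGrading D) m) (hw : w ∈ tensorGrading (weightGrading D) n) :
    z * w ∈ tensorGrading (weightGrading D) (m + n) := by
  have h : tensorGrading (weightGrading D) m * tensorGrading (weightGrading D) n ≤
      tensorGrading (weightGrading D) (m + n) := by
    rw [tensorGrading, tensorGrading, Submodule.span_mul_span, Submodule.span_le]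
    rintro _ ⟨_, ⟨k, l, a, b, rfl, ha, hb, rfl⟩, _, ⟨k', l', a', b', rfl, ha', hb', rfl⟩, rfl⟩
    exact Submodule.subset_span ⟨k + k', l + l', a * a', b * b', by omega,
      SetLike.mul_mem_graded ha ha', SetLike.mul_mem_graded hb hb',
      Algebra.TensorProduct.tmul_mul_tmul _ _ _ _⟩
  exact h (Submodule.mul_mem_mul hz hw)

theorem tmul_mem {m n k : ℕ} {a b : HPR D} (ha : a ∈ weightGrading D m)
    (hb : b ∈ weightGrading D n) (h : m + n = k) :
    a ⊗ₜ b ∈ tensorGrading (weightGrading D) k :=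
  Submodule.subset_span ⟨m, n, a, b, h, ha, hb, rfl⟩

theorem one_mem_weightGrading : (1 : HPR D) ∈ weightGrading D 0 := forest_mem []

theorem comulTree_mem (t : PTree D) : comulTree t ∈ tensorGrading (weightGrading D) (weight t) :=
  add_mem (add_mem (tmul_mem (tree_mem t) one_mem_weightGrading (add_zero _))
    (tmul_mem one_mem_weightGrading (tree_mem t) (zero_add _)))
    (sum_mem fun c _ => tmul_mem (forest_mem _) (tree_mem _) (weight_cut t c))

theorem comul_mem (n : ℕ) (x : HPR D) (hx : x ∈ weightGrading D n) :
    Coalgebra.comul (R := ℚ) x ∈ tensorGrading (weightGrading D) n := by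
  rw [comul_eq]
  induction hx using Submodule.span_induction with
  | zero => simp
  | add x y _ _ hx hy => simpa only [map_add] using add_mem hx hy
  | smul r x _ hx => simpa only [map_smul] using Submodule.smul_mem _ r hx
  | mem x hx =>
    obtain ⟨F, rfl, rfl⟩ := hx
    induction F with
    | nil =>
      rw [forest_nil, map_one]
      exact tmul_mem one_mem_weightGrading one_mem_weightGrading rfl
    | cons t F ih =>
      rw [forest_cons, map_mul, comulHom_tree]
      exact tensorGrading_mul_mem (comulTree_mem t) ih

theorem counit_eq_zero (n : ℕ) (hn : n ≠ 0) (x : HPR D) (hx : x ∈ weightGrading D n) :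
    Coalgebra.counit (R := ℚ) x = 0 := by
  rw [counit_eq]
  induction hx using Submodule.span_induction with
  | zero => simp
  | add x y _ _ hx hy => rw [map_add, hx, hy, add_zero]
  | smul r x _ hx => rw [map_smul, hx, smul_zero]
  | mem x hx =>
    obtain ⟨F, rfl, rfl⟩ := hx
    cases F with
    | nil => exact absurd rfl hn
    | cons t F => rw [forest_cons, map_mul, counitHom_tree, zero_mul]

theorem algebraMap_counit (x : HPR D) (hx : x ∈ weightGrading D 0) :
    algebraMap ℚ (HPR D) (Coalgebra.counit (R := ℚ) x) = x := by
  rw [counit_eq]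
  induction hx using Submodule.span_induction with
  | zero => simp
  | add x y _ _ hx hy => rw [map_add, map_add, hx, hy]
  | smul r x _ hx => rw [map_smul, smul_eq_mul, map_mul, hx, Algebra.smul_def]
  | mem x hx =>
    obtain ⟨F, hF, rfl⟩ := hx
    rcases F with _ | ⟨⟨d, G⟩, F⟩
    · simp
    · simp [weightForest, weight] at hF

/-- The antipode is the convolution inverse of the identity. -/
noncomputable instance : HopfAlgebra ℚ (HPR D) :=
  HopfAlgebra.ofConvInverse (convInverse (weightGrading D))
    (convInverse_mul comul_mem algebraMap_counit) (mul_convInverse comul_mem algebraMap_counit)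

instance [Finite D] : IsGradedHopfAlgebra (weightGrading D) where
  comul_mem := comul_mem
  counit_eq_zero := counit_eq_zero
  antipode_mem := convInverse_mem comul_mem counit_eq_zero
  finite := inferInstance

theorem gamma_forest (d : D) (F : List (PTree D)) [Decidable (F.getLast? = some (node d []))] :
    gamma d (forest F) = if F.getLast? = some (node d []) then forest F.dropLast else 0 := by
  rw [gamma, ← forestBasis_apply, Module.Basis.constr_basis]
  congr

theorem gamma_homogeneous (d : D) :
    GradedDual.IsHomogeneousOfDegree (weightGrading D) (gamma d) (-1) := by
  classical
  intro n x hx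
  rcases n with _ | n
  · right
    induction hx using Submodule.span_induction with
    | zero => simp
    | add x y _ _ hx hy => rw [map_add, hx, hy, add_zero]
    | smul r x _ hx => rw [map_smul, hx, smul_zero]
    | mem x hx =>
      obtain ⟨F, hF, rfl⟩ := hx
      rcases F with _ | ⟨⟨d, G⟩, F⟩
      · simp [gamma_forest, -forest_nil]
      · simp [weightForest, weight] at hF
  · left
    refine ⟨n, by simp, ?_⟩
    induction hx using Submodule.span_induction with
    | zero => simp
    | add x y _ _ hx hy => simpa only [map_add] using add_mem hx hy
    | smul r x _ hx => simpa only [map_smul] using Submodule.smul_mem _ r hx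
    | mem x hx =>
      obtain ⟨F, hF, rfl⟩ := hx
      rw [gamma_forest]
      split_ifs with h
      · have h2 : weightForest F = n + 1 := hF
        rw [← List.dropLast_append_getLast? _ h, weightForest_append] at h2
        obtain rfl : weightForest F.dropLast = n := by
          simpa [weightForest, weight] using h2
        exact forest_mem _
      · exact zero_mem _

/-- The transpose `γ_d^{*g}` on the graded dual. -/
noncomputable def gammaDual [Finite D] (d : D) :
    GradedDual (weightGrading D) →ₗ[ℚ] GradedDual (weightGrading D) :=
  GradedDual.transpose (gamma d) (gamma_homogeneous d)

end HPR

namespace GradedDual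

open Coalgebra HopfAlgebra WithConv

variable {K A : Type*} [Field K] [Ring A] [HopfAlgebra K A] {𝒜 : ℕ → Submodule K A}
  [GradedAlgebra 𝒜] [IsGradedHopfAlgebra 𝒜]

theorem comul_eq_comulDual (f : GradedDual 𝒜) : comul (R := K) f = comulDual 𝒜 f := rfl

theorem one_mem_grading : (1 : GradedDual 𝒜) ∈ grading 𝒜 0 := fun k hk x hx => by
  rw [toDual_one, IsGradedHopfAlgebra.counit_eq_zero (K := K) (𝒜 := 𝒜) k hk x hx]

theorem mul_mem_grading {m n : ℕ} {f g : GradedDual 𝒜} (hf : f ∈ grading 𝒜 m)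
    (hg : g ∈ grading 𝒜 n) : f * g ∈ grading 𝒜 (m + n) := by
  intro k hk x hx
  refine (conv_congr 𝒜 (f.1) (g.1) 0 0 (IsGradedHopfAlgebra.comul_mem k x hx) ?_).trans (by simp)
  intro i j a b hij ha hb
  change toDual f a * toDual g b = 0 * 0
  rcases eq_or_ne i m with rfl | hi
  · rw [hg j (by omega) b hb]
    simp
  · rw [hf i hi a ha]
    simp

end GradedDual

/-- A morphism of bialgebras between Hopf algebras is compatible with the antipodes. -/
theorem BialgHom.map_antipode {R A B : Type*} [CommRing R] [Ring A] [Ring B] [HopfAlgebra R A]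
    [HopfAlgebra R B] (f : A →ₐc[R] B) (x : A) :
    f (HopfAlgebra.antipode R x) = HopfAlgebra.antipode R (f x) := by
  let φ : A →ₗ[R] B := (f : A →ₐ[R] B).toLinearMap
  let u : WithConv (A →ₗ[R] B) := WithConv.toConv φ
  let v : WithConv (A →ₗ[R] B) := WithConv.toConv (φ ∘ₗ HopfAlgebra.antipode R)
  let w : WithConv (A →ₗ[R] B) := WithConv.toConv (HopfAlgebra.antipode R ∘ₗ φ)
  have hvu : v * u = 1 := by
    refine WithConv.ext (LinearMap.ext fun a => ?_)
    change LinearMap.mul' R B (TensorProduct.map (φ ∘ₗ HopfAlgebra.antipode R) φ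
      (Coalgebra.comul a)) = algebraMap R B (Coalgebra.counit a)
    have h : ∀ z : A ⊗[R] A, LinearMap.mul' R B (TensorProduct.map
        (φ ∘ₗ HopfAlgebra.antipode R) φ z) =
        φ (LinearMap.mul' R A ((HopfAlgebra.antipode R).rTensor A z)) := by
      intro z
      induction z with
      | zero => simp
      | tmul a b => simp [φ]
      | add z w hz hw => simp only [map_add, hz, hw]
    rw [h, HopfAlgebra.mul_antipode_rTensor_comul_apply]
    exact (f : A →ₐ[R] B).commutes _
  have huw : u * w = 1 := by
    refine WithConv.ext (LinearMap.ext fun a => ?_)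
    change LinearMap.mul' R B (TensorProduct.map φ (HopfAlgebra.antipode R ∘ₗ φ)
      (Coalgebra.comul a)) = algebraMap R B (Coalgebra.counit a)
    have h : ∀ z : A ⊗[R] A, LinearMap.mul' R B (TensorProduct.map φ
        (HopfAlgebra.antipode R ∘ₗ φ) z) =
        LinearMap.mul' R B ((HopfAlgebra.antipode R).lTensor B (TensorProduct.map φ φ z)) := by
      intro z
      induction z with
      | zero => simp
      | tmul a b => simp
      | add z w hz hw => simp only [map_add, hz, hw]
    have hf : TensorProduct.map φ φ (Coalgebra.comul (R := R) a) = Coalgebra.comul (f a) :=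
      CoalgHomClass.map_comp_comul_apply f a
    rw [h, hf, HopfAlgebra.mul_antipode_lTensor_comul_apply]
    exact congrArg _ (CoalgHomClass.counit_comp_apply f a)
  have h := left_inv_eq_right_inv hvu huw
  exact LinearMap.congr_fun (congrArg WithConv.ofConv h) x

namespace HPR

open PTree Coalgebra GradedDual

variable {D : Type*}

theorem linearMap_ext_forest {M : Type*} [AddCommGroup M] [Module ℚ M] {f g : HPR D →ₗ[ℚ] M}
    (h : ∀ F, f (forest F) = g (forest F)) : f = g :=
  (forestBasis D).ext fun F => by rw [forestBasis_apply, h]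

theorem gamma_one (d : D) : gamma d (1 : HPR D) = 0 := by
  classical
  rw [← forest_nil, gamma_forest]
  simp

open Classical in
theorem gamma_concat (d : D) (F : List (PTree D)) (t : PTree D) :
    gamma d (forest (F ++ [t])) = if t = node d [] then forest F else 0 := by
  rw [gamma_forest]
  simp only [List.getLast?_append, List.getLast?_singleton, List.dropLast_concat, Option.some_or,
    Option.some.injEq]

/-- `γ_d(xy) = γ_d(x) ε(y) + x γ_d(y)`. -/
theorem gamma_mul (d : D) (x y : HPR D) :
    gamma d (x * y) = counitHom D y • gamma d x + x * gamma d y := by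
  classical
  have h : (LinearMap.mul ℚ (HPR D)).compr₂ (gamma d) =
      (LinearMap.lsmul ℚ (HPR D)).flip.compl₁₂ (gamma d) (counitHom D).toLinearMap +
        (LinearMap.mul ℚ (HPR D)).compl₂ (gamma d) := by
    refine linearMap_ext_forest fun F => linearMap_ext_forest fun G => ?_
    change gamma d (forest F * forest G) =
      counitHom D (forest G) • gamma d (forest F) + forest F * gamma d (forest G)
    rcases List.eq_nil_or_concat G with rfl | ⟨G, t, rfl⟩
    · simp [gamma_one]
    · have h0 : counitHom D (forest (G ++ [t])) = 0 := by simp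
      rw [List.concat_eq_append, h0, ← forest_append, ← List.append_assoc, gamma_concat,
        gamma_concat, zero_smul, zero_add, mul_ite, mul_zero, forest_append]
  exact LinearMap.congr_fun₂ h x y

theorem gamma_graft [DecidableEq D] (d e : D) (x : HPR D) :
    gamma d (graft e x) = if d = e then counitHom D x • 1 else 0 := by
  classical
  have h : gamma d ∘ₗ graft e =
      if d = e then (counitHom D).toLinearMap.smulRight (1 : HPR D) else 0 := by
    refine linearMap_ext_forest fun F => ?_
    rw [LinearMap.comp_apply, graft_forest, ← mul_one (tree _), ← forest_nil, ← forest_cons,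
      gamma_forest]
    rcases F with _ | ⟨t, F⟩
    · by_cases hde : d = e
      · simp [hde]
      · simp [hde, Ne.symm hde]
    · by_cases hde : d = e <;> simp [hde]
  have := LinearMap.congr_fun h x
  rw [LinearMap.comp_apply] at this
  rw [this]
  split_ifs <;> rfl

section Psi

variable [Finite D]

theorem toDual_gammaDual (d : D) (f : GradedDual (weightGrading D)) (x : HPR D) :
    toDual (gammaDual d f) x = toDual f (gamma d x) := rfl

/-- `γ_d^{*g}` satisfies the same cocycle identity as `B_d^+`. -/
theorem comul_gammaDual (d : D) (f : GradedDual (weightGrading D)) :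
    comul (R := ℚ) (gammaDual d f) =
      gammaDual d f ⊗ₜ 1 + (gammaDual d).lTensor _ (comul (R := ℚ) f) := by
  apply theta_injective
  refine TensorProduct.ext' fun x y => ?_
  have h : ∀ w, theta (weightGrading D) ((gammaDual d).lTensor _ w) (x ⊗ₜ y) =
      theta (weightGrading D) w (x ⊗ₜ gamma d y) := by
    intro w
    induction w with
    | zero => simp
    | tmul a b => simp [toDual_gammaDual]
    | add v w hv hw => simp only [map_add, LinearMap.add_apply, hv, hw]
  rw [map_add, LinearMap.add_apply, h, comul_eq_comulDual, comul_eq_comulDual, theta_comulDual,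
    theta_comulDual, theta_tmul, toDual_gammaDual, toDual_gammaDual, gamma_mul, map_add, map_smul,
    GradedDual.toDual_one, counit_eq, smul_eq_mul, mul_comm]

theorem gammaDual_mem_grading (d : D) {n : ℕ} {f : GradedDual (weightGrading D)}
    (hf : f ∈ grading (weightGrading D) n) : gammaDual d f ∈ grading (weightGrading D) (n + 1) := by
  intro k hk x hx
  rw [toDual_gammaDual]
  rcases gamma_homogeneous d k x hx with ⟨m, hm, hmem⟩ | h0
  · exact hf m (by omega) _ hmem
  · rw [h0, map_zero]

mutual

/-- The image of a tree under the morphism `Ψ`. -/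
noncomputable def psiTree : PTree D → GradedDual (weightGrading D)
  | node d ts => gammaDual d (psiForest ts)

/-- The image of a forest under the morphism `Ψ`. -/
noncomputable def psiForest : List (PTree D) → GradedDual (weightGrading D)
  | [] => 1
  | t :: ts => psiTree t * psiForest ts

end

/-- The morphism `Ψ`, as a morphism of algebras. -/
noncomputable def psiAlgHom (D : Type*) [Finite D] : HPR D →ₐ[ℚ] GradedDual (weightGrading D) :=
  FreeAlgebra.lift ℚ psiTree

theorem psiAlgHom_forest (F : List (PTree D)) : psiAlgHom D (forest F) = psiForest F := by
  induction F with
  | nil => rw [forest_nil, map_one, psiForest]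
  | cons t F ih =>
    rw [forest_cons, map_mul, ih, psiForest, psiAlgHom, tree, FreeAlgebra.lift_ι_apply]

theorem psiAlgHom_graft (d : D) (x : HPR D) :
    psiAlgHom D (graft d x) = gammaDual d (psiAlgHom D x) := by
  have h : (psiAlgHom D).toLinearMap ∘ₗ graft d = gammaDual d ∘ₗ (psiAlgHom D).toLinearMap := by
    refine linearMap_ext_forest fun F => ?_
    change psiAlgHom D (graft d (forest F)) = gammaDual d (psiAlgHom D (forest F))
    rw [graft_forest, psiAlgHom_forest, psiAlgHom, tree, FreeAlgebra.lift_ι_apply, psiTree]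
  exact LinearMap.congr_fun h x

/-- The morphism `Ψ`, as a morphism of bialgebras. -/
noncomputable def psi (D : Type*) [Finite D] : HPR D →ₐc[ℚ] GradedDual (weightGrading D) :=
  BialgHom.ofAlgHom (psiAlgHom D)
    (by
      refine algHom_ext_graft fun d x _ => ?_
      change toDual (psiAlgHom D (graft d x)) 1 = counitHom D (graft d x)
      rw [psiAlgHom_graft, toDual_gammaDual, gamma_one, map_zero, counitHom_graft])
    (by
      refine algHom_ext_graft fun d x hx => ?_
      change Algebra.TensorProduct.map (psiAlgHom D) (psiAlgHom D) (comulHom D x) =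
        comul (R := ℚ) (psiAlgHom D x) at hx
      change Algebra.TensorProduct.map (psiAlgHom D) (psiAlgHom D) (comulHom D (graft d x)) =
        comul (R := ℚ) (psiAlgHom D (graft d x))
      have h : ∀ z : HPR D ⊗[ℚ] HPR D, Algebra.TensorProduct.map (psiAlgHom D) (psiAlgHom D)
          ((graft d).lTensor _ z) = (gammaDual d).lTensor _
            (Algebra.TensorProduct.map (psiAlgHom D) (psiAlgHom D) z) := by
        intro z
        induction z with
        | zero => simp
        | tmul a b => simp [psiAlgHom_graft]
        | add z w hz hw => simp only [map_add, hz, hw]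
      rw [psiAlgHom_graft, comul_gammaDual, comulHom_graft, map_add, h, hx,
        Algebra.TensorProduct.map_tmul, map_one, psiAlgHom_graft])

theorem psi_graft (d : D) (x : HPR D) : psi D (graft d x) = gammaDual d (psi D x) :=
  psiAlgHom_graft d x

mutual

theorem psiTree_mem : (t : PTree D) → psiTree t ∈ grading (weightGrading D) (weight t)
  | node d ts => by
    rw [psiTree, weight]
    exact gammaDual_mem_grading d (psiForest_mem ts)

theorem psiForest_mem : (F : List (PTree D)) →
    psiForest F ∈ grading (weightGrading D) (weightForest F)
  | [] => by
    rw [psiForest, weightForest]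
    exact one_mem_grading
  | t :: ts => by
    rw [psiForest, weightForest]
    exact mul_mem_grading (psiTree_mem t) (psiForest_mem ts)

end

theorem psi_mem_grading {n : ℕ} {x : HPR D} (hx : x ∈ weightGrading D n) :
    psi D x ∈ grading (weightGrading D) n := by
  induction hx using Submodule.span_induction with
  | zero => rw [map_zero]; exact zero_mem _
  | add x y _ _ hx hy => rw [map_add]; exact add_mem hx hy
  | smul r x _ hx => rw [map_smul]; exact Submodule.smul_mem _ r hx
  | mem x hx =>
    obtain ⟨F, rfl, rfl⟩ := hx
    change psiAlgHom D (forest F) ∈ _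
    rw [psiAlgHom_forest]
    exact psiForest_mem F

end Psi

/-- The span of the tensors `a ⊗ F` where `F` is a forest of weight less than `m`. -/
def lowSecond (D : Type*) (m : ℕ) : Submodule ℚ (HPR D ⊗[ℚ] HPR D) :=
  Submodule.span ℚ {z | ∃ a F, weightForest F < m ∧ z = a ⊗ₜ[ℚ] forest F}

theorem tmul_mem_lowSecond {m : ℕ} (a : HPR D) {F : List (PTree D)} (h : weightForest F < m) :
    a ⊗ₜ forest F ∈ lowSecond D m :=
  Submodule.subset_span ⟨a, F, h, rfl⟩

theorem lowSecond_mono {m n : ℕ} (h : m ≤ n) : lowSecond D m ≤ lowSecond D n :=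
  Submodule.span_mono fun _ ⟨a, F, hF, hz⟩ => ⟨a, F, hF.trans_le h, hz⟩

theorem map_mem_lowSecond {m n : ℕ} {L : HPR D ⊗[ℚ] HPR D →ₗ[ℚ] HPR D ⊗[ℚ] HPR D}
    (h : ∀ a F, weightForest F < m → L (a ⊗ₜ forest F) ∈ lowSecond D n)
    {z : HPR D ⊗[ℚ] HPR D} (hz : z ∈ lowSecond D m) : L z ∈ lowSecond D n := by
  have : lowSecond D m ≤ (lowSecond D n).comap L := by
    rw [lowSecond, Submodule.span_le]
    rintro _ ⟨a, F, hF, rfl⟩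
    exact h a F hF
  exact this hz

theorem mul_mem_lowSecond {m n k : ℕ} (h : m + n ≤ k + 1) {z w : HPR D ⊗[ℚ] HPR D}
    (hz : z ∈ lowSecond D m) (hw : w ∈ lowSecond D n) : z * w ∈ lowSecond D k := by
  have : lowSecond D m * lowSecond D n ≤ lowSecond D k := by
    rw [lowSecond, lowSecond, Submodule.span_mul_span, Submodule.span_le]
    rintro _ ⟨_, ⟨a, F, hF, rfl⟩, _, ⟨b, G, hG, rfl⟩, rfl⟩
    change (a ⊗ₜ[ℚ] forest F) * (b ⊗ₜ[ℚ] forest G) ∈ _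
    rw [Algebra.TensorProduct.tmul_mul_tmul, ← forest_append]
    exact tmul_mem_lowSecond _ (by rw [weightForest_append]; omega)
  exact this (Submodule.mul_mem_mul hz hw)

theorem lTensor_graft_mem_lowSecond (d : D) {m : ℕ} {z : HPR D ⊗[ℚ] HPR D}
    (hz : z ∈ lowSecond D m) : (graft d).lTensor (HPR D) z ∈ lowSecond D (m + 1) := by
  refine map_mem_lowSecond (fun a F hF => ?_) hz
  rw [LinearMap.lTensor_tmul, graft_forest, ← mul_one (tree _), ← forest_nil, ← forest_cons]
  exact tmul_mem_lowSecond _ (by simp only [weightForest, weight]; omega)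

theorem lTensor_gamma_mem_lowSecond (d : D) {m : ℕ} {z : HPR D ⊗[ℚ] HPR D}
    (hz : z ∈ lowSecond D (m + 1)) : (gamma d).lTensor (HPR D) z ∈ lowSecond D m := by
  classical
  refine map_mem_lowSecond (fun a F hF => ?_) hz
  rw [LinearMap.lTensor_tmul]
  rcases List.eq_nil_or_concat F with rfl | ⟨F, t, rfl⟩
  · simp [gamma_one]
  · rw [List.concat_eq_append] at hF ⊢
    rw [gamma_concat]
    split_ifs with ht
    · subst ht
      rw [weightForest_append] at hF
      simp only [weightForest, weight] at hF
      exact tmul_mem_lowSecond _ (by omega)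
    · simp

theorem one_tmul_mem_lowSecond (F : List (PTree D)) :
    (1 : HPR D) ⊗ₜ forest F ∈ lowSecond D (weightForest F + 1) :=
  tmul_mem_lowSecond _ (Nat.lt_succ_self _)

mutual

theorem comulHom_tree_sub_mem : (t : PTree D) →
    comulHom D (tree t) - 1 ⊗ₜ tree t ∈ lowSecond D (weight t)
  | node d ts => by
    have h := lTensor_graft_mem_lowSecond d (comulHom_forest_sub_mem ts)
    rw [map_sub, LinearMap.lTensor_tmul, graft_forest] at h
    rw [← graft_forest, comulHom_graft, add_sub_assoc, graft_forest, weight]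
    refine add_mem ?_ h
    rw [← forest_nil (D := D)]
    exact tmul_mem_lowSecond _ (by simp [weightForest])

/-- `1 ⊗ F` is the part of `Δ(F)` whose second factor has the weight of `F`. -/
theorem comulHom_forest_sub_mem : (F : List (PTree D)) →
    comulHom D (forest F) - 1 ⊗ₜ forest F ∈ lowSecond D (weightForest F)
  | [] => by simp [Algebra.TensorProduct.one_def]
  | t :: ts => by
    have h1 := comulHom_tree_sub_mem t
    have h2 := comulHom_forest_sub_mem ts
    have h3 : comulHom D (forest ts) ∈ lowSecond D (weightForest ts + 1) := by
      have := add_mem (lowSecond_mono (Nat.le_succ _) h2) (one_tmul_mem_lowSecond ts)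
      rwa [sub_add_cancel] at this
    have h4 : (1 : HPR D) ⊗ₜ[ℚ] tree t ∈ lowSecond D (weight t + 1) := by
      simpa [weightForest] using one_tmul_mem_lowSecond [t]
    have h5 : comulHom D (forest (t :: ts)) - 1 ⊗ₜ forest (t :: ts) =
        (comulHom D (tree t) - 1 ⊗ₜ tree t) * comulHom D (forest ts) +
          (1 ⊗ₜ tree t) * (comulHom D (forest ts) - 1 ⊗ₜ forest ts) := by
      rw [sub_mul, mul_sub, forest_cons, map_mul, Algebra.TensorProduct.tmul_mul_tmul, one_mul]
      abel
    rw [h5, weightForest]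
    exact add_mem (mul_mem_lowSecond (by omega) h1 h3) (mul_mem_lowSecond (by omega) h4 h2)

end

theorem comulHom_forest_mem_lowSecond (F : List (PTree D)) :
    comulHom D (forest F) ∈ lowSecond D (weightForest F + 1) := by
  have := add_mem (lowSecond_mono (Nat.le_succ _) (comulHom_forest_sub_mem F))
    (one_tmul_mem_lowSecond F)
  rwa [sub_add_cancel] at this

/-- `(id ⊗ γ_d) ∘ Δ`, the transpose of `x ⊗ y ↦ x B_d^+(y)` under the pairing defined by `Ψ`. -/
noncomputable def cogamma (d : D) : HPR D →ₗ[ℚ] HPR D ⊗[ℚ] HPR D :=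
  (gamma d).lTensor (HPR D) ∘ₗ (comulHom D).toLinearMap

theorem cogamma_apply (d : D) (x : HPR D) :
    cogamma d x = (gamma d).lTensor (HPR D) (comulHom D x) := rfl

theorem lTensor_gamma_mul_lTensor_graft [DecidableEq D] (d e : D) (z w : HPR D ⊗[ℚ] HPR D) :
    (gamma d).lTensor (HPR D) (z * (graft e).lTensor (HPR D) w) =
      if d = e then z * (TensorProduct.rid ℚ (HPR D)
        ((counitHom D).toLinearMap.lTensor (HPR D) w) ⊗ₜ 1) else 0 := by
  induction z with
  | zero => simp
  | add z z' hz hz' =>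
    rw [add_mul, map_add, hz, hz', add_mul]
    split_ifs <;> simp
  | tmul a b =>
    induction w with
    | zero => simp
    | add z z' hz hz' =>
      rw [map_add, mul_add, map_add, hz, hz', map_add, map_add, TensorProduct.add_tmul, mul_add]
      split_ifs <;> simp
    | tmul p q =>
      rw [LinearMap.lTensor_tmul, Algebra.TensorProduct.tmul_mul_tmul, LinearMap.lTensor_tmul,
        gamma_mul, counitHom_graft, gamma_graft]
      split_ifs
      · simp [TensorProduct.smul_tmul', TensorProduct.tmul_smul]
      · simp

/-- `cogamma d (F B_e^+(G))` equals `G ⊗ F` (if `d = e`, and `0` otherwise) up to terms whose second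
factor has a smaller weight than `F`. -/
theorem cogamma_concat_sub_mem [DecidableEq D] (d e : D) (F G : List (PTree D)) :
    cogamma d (forest (F ++ [node e G])) - (if d = e then forest G ⊗ₜ[ℚ] forest F else 0) ∈
      lowSecond D (weightForest F) := by
  have hG : TensorProduct.rid ℚ (HPR D) ((counitHom D).toLinearMap.lTensor (HPR D)
      (comulHom D (forest G))) = forest G := by
    have h := Coalgebra.lTensor_counit_comul (R := ℚ) (forest G)
    change (counitHom D).toLinearMap.lTensor (HPR D) (comulHom D (forest G)) = _ at h
    rw [h]
    simp
  have h1 : ∀ a : HPR D, a ⊗ₜ (1 : HPR D) ∈ lowSecond D 1 := fun a => by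
    rw [← forest_nil (D := D)]
    exact tmul_mem_lowSecond _ (by simp [weightForest])
  rw [cogamma_apply, forest_append, forest_cons, forest_nil, mul_one, map_mul, ← graft_forest,
    comulHom_graft, mul_add, map_add, lTensor_gamma_mul_lTensor_graft, hG, add_sub_assoc]
  refine add_mem (lTensor_gamma_mem_lowSecond d
    (mul_mem_lowSecond le_rfl (comulHom_forest_mem_lowSecond F) (h1 _))) ?_
  split_ifs
  · have h2 : comulHom D (forest F) * (forest G ⊗ₜ 1) - forest G ⊗ₜ forest F =
        (comulHom D (forest F) - 1 ⊗ₜ forest F) * (forest G ⊗ₜ 1) := by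
      rw [sub_mul, Algebra.TensorProduct.tmul_mul_tmul, one_mul, mul_one]
    rw [h2]
    exact mul_mem_lowSecond le_rfl (comulHom_forest_sub_mem F) (h1 _)
  · simp

/-- The coordinate of `H ⊗ H` along `G ⊗ F`. -/
noncomputable def tensorCoord (G F : List (PTree D)) : HPR D ⊗[ℚ] HPR D →ₗ[ℚ] ℚ :=
  LinearMap.mul' ℚ ℚ ∘ₗ TensorProduct.map ((forestBasis D).coord G) ((forestBasis D).coord F)

theorem coord_forest [DecidableEq (List (PTree D))] (F G : List (PTree D)) :
    (forestBasis D).coord F (forest G) = if G = F then 1 else 0 := by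
  rw [← forestBasis_apply, Module.Basis.coord_apply, Module.Basis.repr_self,
    Finsupp.single_apply]

theorem tensorCoord_eq_zero {m : ℕ} {F : List (PTree D)} (h : m ≤ weightForest F)
    (G : List (PTree D)) {z : HPR D ⊗[ℚ] HPR D} (hz : z ∈ lowSecond D m) :
    tensorCoord G F z = 0 := by
  classical
  have : lowSecond D m ≤ LinearMap.ker (tensorCoord G F) := by
    rw [lowSecond, Submodule.span_le]
    rintro _ ⟨a, F', hF, rfl⟩
    have hne : F' ≠ F := by
      rintro rfl
      omega
    simp [tensorCoord, coord_forest, hne, -Module.Basis.coord_apply]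
  exact this hz

theorem tensorCoord_cogamma [DecidableEq (List (PTree D))] (d e : D) (F G F' G' : List (PTree D))
    (h : weightForest F' ≤ weightForest F) :
    tensorCoord G F (cogamma d (forest (F' ++ [node e G']))) =
      if F' ++ [node e G'] = F ++ [node d G] then 1 else 0 := by
  classical
  have h1 := tensorCoord_eq_zero h G (cogamma_concat_sub_mem d e F' G')
  rw [map_sub, sub_eq_zero] at h1
  rw [h1]
  by_cases hd : d = e <;> by_cases hF : F' = F <;> by_cases hG : G' = G <;>
    simp [tensorCoord, coord_forest, hd, hF, hG, Ne.symm, eq_comm, -Module.Basis.coord_apply]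

theorem eq_zero_of_cogamma_eq_zero {y : HPR D} (h0 : counitHom D y = 0)
    (h : ∀ d, cogamma d y = 0) : y = 0 := by
  classical
  by_contra hy
  let c := (forestBasis D).repr y
  have hc : c ≠ 0 := fun hc => hy ((forestBasis D).repr.map_eq_zero_iff.1 hc)
  have hsum : y = ∑ L ∈ c.support, c L • forest L := by
    conv_lhs => rw [← (forestBasis D).linearCombination_repr y]
    simp only [Finsupp.linearCombination_apply, Finsupp.sum, forestBasis_apply]
    rfl
  have hnil : c [] = 0 := by
    rw [hsum, map_sum] at h0
    rw [← h0, Finset.sum_eq_single []]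
    · simp
    · rintro (_ | ⟨t, L⟩) _ hL
      · exact absurd rfl hL
      · simp
    · intro hL
      simp [Finsupp.notMem_support_iff.1 hL]
  obtain ⟨L, hL, hmax⟩ := Finset.exists_max_image c.support
    (fun L => weightForest L.dropLast) (Finsupp.support_nonempty_iff.2 hc)
  rcases List.eq_nil_or_concat L with rfl | ⟨F, ⟨d, G⟩, rfl⟩
  · exact Finsupp.mem_support_iff.1 hL hnil
  rw [List.concat_eq_append] at hL hmax
  have hy' := congrArg (tensorCoord G F) (h d)
  rw [hsum, map_sum, map_sum, map_zero, Finset.sum_eq_single (F ++ [node d G]), map_smul, map_smul,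
    tensorCoord_cogamma d d F G F G le_rfl, if_pos rfl, smul_eq_mul, mul_one] at hy'
  · exact Finsupp.mem_support_iff.1 hL hy'
  · intro L' hL' hne
    rcases List.eq_nil_or_concat L' with rfl | ⟨F', ⟨e, G'⟩, rfl⟩
    · rw [hnil, zero_smul, map_zero, map_zero]
    · rw [List.concat_eq_append] at hL' hne ⊢
      have hw := hmax _ hL'
      rw [List.dropLast_concat, List.dropLast_concat] at hw
      rw [map_smul, map_smul, tensorCoord_cogamma d e F G F' G' hw, if_neg hne, smul_zero]
  · exact fun hL' => absurd hL hL'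

/-- The span of the forests of weight less than `n`. -/
def weightLT (D : Type*) (n : ℕ) : Submodule ℚ (HPR D) :=
  Submodule.span ℚ (forest '' {F : List (PTree D) | weightForest F < n})

theorem weightGrading_le_weightLT {k n : ℕ} (h : k < n) : weightGrading D k ≤ weightLT D n :=
  Submodule.span_mono (Set.image_mono fun _ hF => lt_of_eq_of_lt hF h)

theorem exists_mem_weightLT (y : HPR D) : ∃ n, y ∈ weightLT D n := by
  induction y using DirectSum.Decomposition.inductionOn (weightGrading D) with
  | zero => exact ⟨0, zero_mem _⟩
  | homogeneous m => exact ⟨_, weightGrading_le_weightLT (Nat.lt_succ_self _) m.2⟩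
  | add x y hx hy =>
    obtain ⟨m, hm⟩ := hx
    obtain ⟨n, hn⟩ := hy
    have hmono : ∀ {k}, k ≤ max m n → weightLT D k ≤ weightLT D (max m n) := fun hk =>
      Submodule.span_mono (Set.image_mono fun _ hF => lt_of_lt_of_le hF hk)
    exact ⟨max m n, add_mem (hmono (le_max_left _ _) hm) (hmono (le_max_right _ _) hn)⟩

theorem cogamma_mem_range (d : D) {n : ℕ} {y : HPR D} (hy : y ∈ weightLT D (n + 1)) :
    cogamma d y ∈ LinearMap.range
      (TensorProduct.map (weightLT D n).subtype (weightLT D n).subtype) := by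
  have h : weightLT D (n + 1) ≤ (LinearMap.range
      (TensorProduct.map (weightLT D n).subtype (weightLT D n).subtype)).comap (cogamma d) := by
    rw [weightLT, Submodule.span_le]
    rintro _ ⟨F, hF, rfl⟩
    have hF' : weightForest F < n + 1 := hF
    change (gamma d).lTensor (HPR D) (comulHom D (forest F)) ∈ LinearMap.range
      (TensorProduct.map (weightLT D n).subtype (weightLT D n).subtype)
    have hΔ := comul_mem _ _ (forest_mem F)
    rw [comul_eq] at hΔ
    generalize comulHom D (forest F) = z at hΔ
    induction hΔ using Submodule.span_induction with
    | zero => rw [map_zero]; exact zero_mem _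
    | add z w _ _ hz hw => rw [map_add]; exact add_mem hz hw
    | smul r z _ hz => rw [map_smul]; exact Submodule.smul_mem _ r hz
    | mem z hz =>
      obtain ⟨k, l, a, b, hkl, ha, hb, rfl⟩ := hz
      rw [LinearMap.lTensor_tmul]
      rcases gamma_homogeneous d l b hb with ⟨m, hm, hmem⟩ | h0
      · exact ⟨⟨a, weightGrading_le_weightLT (by omega) ha⟩ ⊗ₜ
          ⟨gamma d b, weightGrading_le_weightLT (by omega) hmem⟩, rfl⟩
      · rw [h0, TensorProduct.tmul_zero]
        exact zero_mem _
  exact h hy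

section Psi

variable [Finite D]

/-- The pairing `⟨x, y⟩ = Ψ(x)(y)`. -/
noncomputable def pairing (D : Type*) [Finite D] : HPR D →ₗ[ℚ] Module.Dual ℚ (HPR D) :=
  toDual ∘ₗ (psiAlgHom D).toLinearMap

theorem pairing_apply (x : HPR D) : pairing D x = toDual (psi D x) := rfl

theorem pairing_mul_graft (d : D) (x x' y : HPR D) : pairing D (x * graft d x') y =
    TensorProduct.dualDistrib ℚ _ _ (pairing D x ⊗ₜ pairing D x') (cogamma d y) := by
  rw [pairing_apply, map_mul, GradedDual.toDual_mul, psi_graft, cogamma_apply, comul_eq]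
  generalize comulHom D y = z
  induction z with
  | zero => simp
  | add z w hz hw => simp only [map_add, hz, hw]
  | tmul a b => simp [toDual_gammaDual, pairing_apply]

theorem pairing_eq_zero {n : ℕ} {x : HPR D} (hx : x ∈ weightGrading D n) {k : ℕ} (hk : k ≠ n)
    {y : HPR D} (hy : y ∈ weightGrading D k) : pairing D x y = 0 :=
  psi_mem_grading hx k hk y hy

theorem eq_zero_of_pairing_of_mem_weightLT (n : ℕ) :
    ∀ y ∈ weightLT D n, (∀ x, pairing D x y = 0) → y = 0 := by
  induction n with
  | zero =>
    intro y hy _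
    simpa [weightLT] using hy
  | succ n ih =>
    intro y hy h
    refine eq_zero_of_cogamma_eq_zero ?_ fun d => ?_
    · have := h 1
      rwa [pairing_apply, map_one, GradedDual.toDual_one, counit_eq] at this
    · obtain ⟨z, hz⟩ := cogamma_mem_range d hy
      let i : weightLT D n →ₗ[ℚ] Module.Dual ℚ (HPR D) := (pairing D).flip ∘ₗ (weightLT D n).subtype
      have hi : Function.Injective i := by
        rw [← LinearMap.ker_eq_bot, LinearMap.ker_eq_bot']
        intro y hy
        exact Subtype.ext (ih y y.2 fun x => LinearMap.congr_fun hy x)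
      have hz0 : z = 0 := by
        apply dualDistrib_injective hi hi
        rw [map_zero]
        refine TensorProduct.ext' fun x x' => ?_
        have h1 : ∀ z, (TensorProduct.dualDistrib ℚ (HPR D) (HPR D) ∘ₗ TensorProduct.map i i) z
            (x ⊗ₜ x') = TensorProduct.dualDistrib ℚ _ _ (pairing D x ⊗ₜ pairing D x')
              (TensorProduct.map (weightLT D n).subtype (weightLT D n).subtype z) := by
          intro z
          induction z with
          | zero => simp
          | add z w hz hw => simp only [map_add, LinearMap.add_apply, hz, hw]
          | tmul a b => simp [i]
        rw [h1, hz, ← pairing_mul_graft, h, LinearMap.zero_apply]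
      rw [← hz, hz0, map_zero]

/-- The pairing is nondegenerate. -/
theorem eq_zero_of_pairing {y : HPR D} (h : ∀ x, pairing D x y = 0) : y = 0 := by
  obtain ⟨n, hn⟩ := exists_mem_weightLT y
  exact eq_zero_of_pairing_of_mem_weightLT n y hn h

/-- The restriction of the pairing to the component of weight `n`. -/
noncomputable def pairingComponent (D : Type*) [Finite D] (n : ℕ) :
    weightGrading D n →ₗ[ℚ] weightGrading D n →ₗ[ℚ] ℚ :=
  (pairing D).compl₁₂ (weightGrading D n).subtype (weightGrading D n).subtype

theorem pairingComponent_bijective (n : ℕ) : Function.Bijective (pairingComponent D n) := by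
  have h : Function.Injective (pairingComponent D n).flip := by
    rw [← LinearMap.ker_eq_bot, LinearMap.ker_eq_bot']
    intro y hy
    refine Subtype.ext (eq_zero_of_pairing fun x => ?_)
    have : (pairing D).flip (y : HPR D) = 0 := by
      refine linearMap_ext_graded (𝒜 := weightGrading D) fun k x hx => ?_
      rcases eq_or_ne n k with rfl | hk
      · exact LinearMap.congr_fun hy ⟨x, hx⟩
      · exact pairing_eq_zero hx hk y.2
    exact LinearMap.congr_fun this x
  have hs := LinearMap.flip_injective_iff₁.1 h
  refine ⟨?_, hs⟩
  refine (LinearMap.injective_iff_surjective_of_finrank_eq_finrank ?_).2 hs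
  exact Subspace.dual_finrank_eq.symm

theorem exists_pairing_eq (n : ℕ) (f : Module.Dual ℚ (HPR D)) :
    ∃ x ∈ weightGrading D n, ∀ y ∈ weightGrading D n, pairing D x y = f y := by
  obtain ⟨x, hx⟩ := (pairingComponent_bijective n).2 (f ∘ₗ (weightGrading D n).subtype)
  exact ⟨x, x.2, fun y hy => LinearMap.congr_fun hx ⟨y, hy⟩⟩

theorem map_psi (n : ℕ) : (weightGrading D n).map (psiAlgHom D).toLinearMap =
    grading (weightGrading D) n := by
  refine le_antisymm ?_ fun f hf => ?_
  · rintro _ ⟨x, hx, rfl⟩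
    exact psi_mem_grading hx
  · obtain ⟨x, hx, h⟩ := exists_pairing_eq n (toDual f)
    refine ⟨x, hx, toDual_injective (linearMap_ext_graded (𝒜 := weightGrading D) fun k y hy => ?_)⟩
    rcases eq_or_ne k n with rfl | hk
    · exact h y hy
    · exact (pairing_eq_zero hx hk hy).trans (hf k hk y hy).symm

theorem psi_injective : Function.Injective (psi D) := by
  refine (injective_iff_map_eq_zero (psi D)).2 fun x hx => ?_
  classical
  have h : ∀ n, (DirectSum.decompose (weightGrading D) x n) = 0 := by
    intro n
    refine (pairingComponent_bijective n).1 ?_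
    rw [map_zero]
    refine LinearMap.ext fun y => ?_
    change pairing D (DirectSum.decompose (weightGrading D) x n : HPR D) y = 0
    have h1 : pairing D x y = 0 := by rw [pairing_apply, hx, map_zero, LinearMap.zero_apply]
    rw [← DirectSum.sum_support_decompose (weightGrading D) x, map_sum, LinearMap.sum_apply,
      Finset.sum_eq_single n] at h1
    · exact h1
    · exact fun k _ hk => pairing_eq_zero (SetLike.coe_mem _) hk.symm y.2
    · intro hn
      rw [DFinsupp.notMem_support_iff.1 hn]
      simp
  rw [← DirectSum.sum_support_decompose (weightGrading D) x]
  exact Finset.sum_eq_zero fun n _ => by rw [h n]; rfl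

theorem psi_surjective : Function.Surjective (psi D) := by
  intro f
  obtain ⟨N, hN⟩ := exists_toDual f
  choose x hx h using fun n => exists_pairing_eq n (toDual f)
  refine ⟨∑ n ∈ Finset.range N, x n,
    toDual_injective (linearMap_ext_graded (𝒜 := weightGrading D) fun k y hy => ?_)⟩
  rw [← pairing_apply, map_sum, LinearMap.sum_apply]
  by_cases hk : k < N
  · rw [Finset.sum_eq_single k, h k y hy]
    · exact fun n _ hn => pairing_eq_zero (hx n) hn.symm hy
    · exact fun hk' => absurd (Finset.mem_range.2 hk) hk'
  · rw [hN k (by omega) y hy]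
    refine Finset.sum_eq_zero fun n hn => pairing_eq_zero (hx n) ?_ hy
    have := Finset.mem_range.1 hn
    omega

end Psi

end HPR

theorem mainTheorem3 (D : Type*) [Finite D] :
    ∃ Ψ : HPR D ≃ₐc[ℚ] GradedDual (HPR.weightGrading D),
      (∀ (d : D) (x : HPR D), Ψ (HPR.graft d x) = HPR.gammaDual d (Ψ x)) ∧
      (∀ x : HPR D, Ψ (HopfAlgebra.antipode ℚ x) = HopfAlgebra.antipode ℚ (Ψ x)) ∧
      (∀ n : ℕ, (HPR.weightGrading D n).map (Ψ : HPR D →ₗ[ℚ] GradedDual (HPR.weightGrading D)) =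
        GradedDual.grading (HPR.weightGrading D) n) ∧
      ∀ Φ : HPR D →ₐc[ℚ] GradedDual (HPR.weightGrading D),
        (∀ (d : D) (x : HPR D), Φ (HPR.graft d x) = HPR.gammaDual d (Φ x)) →
          ∀ x : HPR D, Φ x = Ψ x := by
  refine ⟨BialgEquiv.ofBijective (HPR.psi D) ⟨HPR.psi_injective, HPR.psi_surjective⟩,
    HPR.psi_graft, BialgHom.map_antipode (HPR.psi D), HPR.map_psi, fun Φ hΦ x => ?_⟩
  have h : (Φ : HPR D →ₐ[ℚ] GradedDual (HPR.weightGrading D)) = HPR.psiAlgHom D := by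
    refine HPR.algHom_ext_graft fun d x hx => ?_
    rw [HPR.psiAlgHom_graft, ← hx]
    exact hΦ d x
  exact AlgHom.congr_fun h x
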